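/- Let $p,q$ be odd primes with $p\mid q-1$, and let $G=\mathbb Z/q\mathbb Z\rtimes\mathbb Z/p\mathbb Z$ be the nonabelian group of order $pq$, that is, the semidirect product for a nontrivial action of $\mathbb Z/p\mathbb Z=\langle b\rangle$ on $\mathbb Z/q\mathbb Z$. Let $\omega\colon G^3\to\mathbb C^\times$ be the inflation along the projection $G\to\langle b\rangle$ of the generating three-cocycle $$\omega(b^i,b^j,b^k)=\exp\Bigl(\tfrac{2\pi\sqrt{-1}}{p^2}\,[i]\bigl([j]+[k]-[j+k]\bigr)\Bigr),$$ where $[i]\in\{0,\dots,p-1\}$ denotes the representative of $i$ modulo $p$. For $u\in\{0,\dots,p-1\}$ let $\mathrm{Vect}_G^{\omega^u}$ be the category of finite-dimensional $G$-graded complex vector spaces with associativity constraint $(x\otimes y)\otimes z\mapsto\omega(|x|,|y|,|z|)^u\,x\otimes(y\otimes z)$, and let $\mathcal Z(\mathrm{Vect}_G^{\omega^u})$ be its (right) Drinfeld center, with braiding $\sigma$ and with the canonical pivotal structure, for which the pivotal trace $\mathrm{ptr}$ is the trace of the underlying linear map. For simple objects $U,V,W$ of this center let $$T_V=\frac{\mathrm{ptr}(\sigma_{V,V})}{\dim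 V}$$ be the twist of $V$, and let $$B_{U,V,W}=\mathrm{ptr}\bigl((\sigma_2^{-1}\sigma_1)^3\bigr)$$ be the borromean tensor, the trace of the indicated three-strand braid (whose closure is the borromean rings) acting on $(U\otimes V)\otimes W$. Then the $T$-matrix and the $B$-tensor form a complete set of invariants for the $p$ modular categories $\mathcal Z(\mathrm{Vect}_G^{\omega^u})$, $u=0,\dots,p-1$, in the following sense: for $u,u'\in\{0,\dots,p-1\}$ there is a map $\kappa$ from the simple objects of $\mathcal Z(\mathrm{Vect}_G^{\omega^u})$ to the simple objects of $\mathcal Z(\mathrm{Vect}_G^{\omega^{u'}})$ (not assumed to be bijective) with $T_{\kappa(V)}=T_V$ and $B_{\kappa(U),\kappa(V),\kappa(W)}=B_{U,V,W}$ for all simple objects $U,V,W$ of the former if and only if $u=u'$. -/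

import Mathlib

open CategoryTheory MonoidalCategory TensorProduct

/-- A normalized three-cocycle on the group `G` with values in `ℂˣ` (trivial action). -/
structure ThreeCocycle (G : Type) [Group G] where
  val : G → G → G → ℂˣ
  one_left : ∀ x y, val 1 x y = 1
  one_mid : ∀ x y, val x 1 y = 1
  one_right : ∀ x y, val x y 1 = 1
  cocycle : ∀ w x y z,
    val w x y * val w (x * y) z * val x y z = val (w * x) y z * val w x (y * z)

namespace ThreeCocycle

variable {G H : Type} [Group G] [Group H]

/-- The pointwise power `ω ^ u`. -/
def pow (ω : ThreeCocycle G) (u : ℕ) : ThreeCocycle G where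
  val x y z := ω.val x y z ^ u
  one_left x y := by simp [ω.one_left]
  one_mid x y := by simp [ω.one_mid]
  one_right x y := by simp [ω.one_right]
  cocycle w x y z := by rw [← mul_pow, ← mul_pow, ← mul_pow, ω.cocycle]

/-- The inflation (pullback) of a cocycle along a group homomorphism. -/
def inflate (ω : ThreeCocycle H) (f : G →* H) : ThreeCocycle G where
  val x y z := ω.val (f x) (f y) (f z)
  one_left x y := by simp [ω.one_left]
  one_mid x y := by simp [ω.one_mid]
  one_right x y := by simp [ω.one_right]
  cocycle w x y z := by simp [ω.cocycle]

/-- A complex exponential, as a unit. -/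
noncomputable def expUnit (z : ℂ) : ℂˣ := Units.mk0 (Complex.exp z) (Complex.exp_ne_zero z)

/-- The integer `[j] + [k] - [j + k]`, where `[i] ∈ {0, …, p - 1}` represents `i ∈ ℤ/p`. -/
def carry (p : ℕ) (j k : ZMod p) : ℤ := (j.val : ℤ) + (k.val : ℤ) - ((j + k).val : ℤ)

lemma carry_dvd (p : ℕ) [NeZero p] (j k : ZMod p) : (p : ℤ) ∣ carry p j k := by
  rw [← ZMod.intCast_zmod_eq_zero_iff_dvd]
  simp [carry]

/-- The standard generator of `H³(ℤ/p, ℂˣ)`,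
`ω(bⁱ, bʲ, bᵏ) = exp (2πi / p² · [i] ([j] + [k] - [j + k]))`. -/
noncomputable def standard (p : ℕ) [NeZero p] : ThreeCocycle (Multiplicative (ZMod p)) where
  val i j k := expUnit (2 * Real.pi * Complex.I / (p : ℂ) ^ 2 *
    (((i.toAdd.val : ℤ) * carry p j.toAdd k.toAdd : ℤ) : ℂ))
  one_left x y := by ext; simp [expUnit]
  one_mid x y := by ext; simp [expUnit, carry]
  one_right x y := by ext; simp [expUnit, carry]
  cocycle w x y z := by
    ext
    simp only [expUnit, Units.val_mul, Units.val_mk0, toAdd_mul, ← Complex.exp_add]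
    rw [Complex.exp_eq_exp_iff_exists_int]
    obtain ⟨m, hm⟩ := carry_dvd p w.toAdd x.toAdd
    obtain ⟨n, hn⟩ := carry_dvd p y.toAdd z.toAdd
    refine ⟨m * n, ?_⟩
    have hp : (p : ℂ) ≠ 0 := Nat.cast_ne_zero.mpr (NeZero.ne p)
    have key : ((w.toAdd.val : ℤ) * carry p x.toAdd y.toAdd
        + (w.toAdd.val : ℤ) * carry p (x.toAdd + y.toAdd) z.toAdd
        + (x.toAdd.val : ℤ) * carry p y.toAdd z.toAdd)
        = ((w.toAdd + x.toAdd).val : ℤ) * carry p y.toAdd z.toAdd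
          + (w.toAdd.val : ℤ) * carry p x.toAdd (y.toAdd + z.toAdd) + p * p * (m * n) := by
      have h1 : (p : ℤ) * p * (m * n) = carry p w.toAdd x.toAdd * carry p y.toAdd z.toAdd := by
        rw [hm, hn]; ring
      rw [h1]
      simp only [carry, add_assoc]
      ring
    have key' := congrArg (Int.cast : ℤ → ℂ) key
    simp only [Int.cast_add, Int.cast_mul, Int.cast_natCast] at key' ⊢
    field_simp
    linear_combination key'

end ThreeCocycle

/-! ### The pointed fusion category `Vect_G^ω` -/

section TwistedDoubles

variable {G : Type} [Group G] [Fintype G]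

/-- An object of `Vect_G^ω` (with the associator `assocIso` below): a finite-dimensional complex vector space with a `G`-grading
`V = ⨁ g, V_g`. The grading is recorded by the projections `proj g` of `V` onto the homogeneous
components `V_g = {v | proj g v = v}`, a complete family of orthogonal idempotents. -/
structure GradedVec (ω : ThreeCocycle G) : Type 1 where
  carrier : Type
  [addCommGroup : AddCommGroup carrier]
  [module : Module ℂ carrier]
  [finite : FiniteDimensional ℂ carrier]
  proj : G → carrier →ₗ[ℂ] carrier
  proj_self : ∀ g v, proj g (proj g v) = proj g v
  proj_ne : ∀ g h v, g ≠ h → proj g (proj h v) = 0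
  sum_proj : ∀ v, ∑ g, proj g v = v

namespace GradedVec

variable {ω : ThreeCocycle G}

attribute [instance] addCommGroup module finite

/-- A morphism of `Vect_G^ω`: a linear map that preserves degrees. -/
@[ext]
structure Hom (V W : GradedVec ω) where
  toLin : V.carrier →ₗ[ℂ] W.carrier
  comm : ∀ g v, toLin (V.proj g v) = W.proj g (toLin v)

instance : Category (GradedVec ω) where
  Hom := Hom
  id V := ⟨LinearMap.id, fun _ _ => rfl⟩
  comp f g := ⟨g.toLin ∘ₗ f.toLin, fun x v => by simp [f.comm, g.comm]⟩

lemma hom_ext {V W : GradedVec ω} (f g : V ⟶ W)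
    (h : ∀ v, Hom.toLin f v = Hom.toLin g v) : f = g :=
  Hom.ext (LinearMap.ext h)

@[simp] lemma id_toLin (V : GradedVec ω) : Hom.toLin (𝟙 V) = LinearMap.id := rfl

@[simp] lemma comp_toLin {U V W : GradedVec ω} (f : U ⟶ V) (g : V ⟶ W) :
    Hom.toLin (f ≫ g) = Hom.toLin g ∘ₗ Hom.toLin f := rfl

instance : Limits.HasZeroMorphisms (GradedVec ω) where
  zero V W := ⟨⟨0, fun _ _ => by simp⟩⟩
  comp_zero f _ := hom_ext _ _ fun _ => rfl
  zero_comp _ _ _ f := hom_ext _ _ fun v => map_zero (Hom.toLin f)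

@[simp] lemma zero_toLin (V W : GradedVec ω) : Hom.toLin (0 : V ⟶ W) = 0 := rfl

/-- `v` is homogeneous of degree `g`. -/
def IsDeg (V : GradedVec ω) (g : G) (v : V.carrier) : Prop := V.proj g v = v

lemma isDeg_proj (V : GradedVec ω) (g : G) (v : V.carrier) : V.IsDeg g (V.proj g v) :=
  V.proj_self g v

lemma IsDeg.ne {V : GradedVec ω} {g h : G} {v : V.carrier} (hv : V.IsDeg g v) (hne : h ≠ g) :
    V.proj h v = 0 := by
  rw [← show V.proj g v = v from hv]; exact V.proj_ne h g v hne

lemma IsDeg.map {V W : GradedVec ω} (f : V ⟶ W) {g : G} {v : V.carrier} (hv : V.IsDeg g v) :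
    W.IsDeg g (Hom.toLin f v) := by
  unfold IsDeg; rw [← Hom.comm, show V.proj g v = v from hv]

lemma lin_ext {V : GradedVec ω} {M : Type} [AddCommGroup M] [Module ℂ M]
    {f g : V.carrier →ₗ[ℂ] M} (h : ∀ x v, V.IsDeg x v → f v = g v) : f = g := by
  ext v
  rw [← V.sum_proj v, map_sum, map_sum]
  exact Finset.sum_congr rfl fun x _ => h x _ (V.isDeg_proj x v)

lemma lin_ext₂ {V W : GradedVec ω} {M : Type} [AddCommGroup M] [Module ℂ M]
    {f g : V.carrier ⊗[ℂ] W.carrier →ₗ[ℂ] M}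
    (h : ∀ x y v w, V.IsDeg x v → W.IsDeg y w → f (v ⊗ₜ w) = g (v ⊗ₜ w)) : f = g := by
  apply TensorProduct.ext
  refine lin_ext fun x v hv => lin_ext fun y w hw => ?_
  simpa using h x y v w hv hw

lemma lin_ext₃ {U V W : GradedVec ω} {M : Type} [AddCommGroup M] [Module ℂ M]
    {f g : (U.carrier ⊗[ℂ] V.carrier) ⊗[ℂ] W.carrier →ₗ[ℂ] M}
    (h : ∀ x y z u v w, U.IsDeg x u → V.IsDeg y v → W.IsDeg z w →
      f ((u ⊗ₜ v) ⊗ₜ w) = g ((u ⊗ₜ v) ⊗ₜ w)) : f = g := by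
  apply TensorProduct.ext
  refine lin_ext₂ fun x y u v hu hv => lin_ext fun z w hw => ?_
  simpa using h x y z u v w hu hv hw

lemma lin_ext₃' {U V W : GradedVec ω} {M : Type} [AddCommGroup M] [Module ℂ M]
    {f g : U.carrier ⊗[ℂ] (V.carrier ⊗[ℂ] W.carrier) →ₗ[ℂ] M}
    (h : ∀ x y z u v w, U.IsDeg x u → V.IsDeg y v → W.IsDeg z w →
      f (u ⊗ₜ (v ⊗ₜ w)) = g (u ⊗ₜ (v ⊗ₜ w))) : f = g := by
  apply TensorProduct.ext
  refine lin_ext fun x u hu => lin_ext₂ fun y z v w hv hw => ?_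
  simpa using h x y z u v w hu hv hw

lemma lin_ext₄ {T U V W : GradedVec ω} {M : Type} [AddCommGroup M] [Module ℂ M]
    {f g : ((T.carrier ⊗[ℂ] U.carrier) ⊗[ℂ] V.carrier) ⊗[ℂ] W.carrier →ₗ[ℂ] M}
    (h : ∀ r x y z t u v w, T.IsDeg r t → U.IsDeg x u → V.IsDeg y v → W.IsDeg z w →
      f (((t ⊗ₜ u) ⊗ₜ v) ⊗ₜ w) = g (((t ⊗ₜ u) ⊗ₜ v) ⊗ₜ w)) : f = g := by
  apply TensorProduct.ext
  refine lin_ext₃ fun r x y t u v ht hu hv => lin_ext fun z w hw => ?_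
  simpa using h r x y z t u v w ht hu hv hw

/-- The projections of `V ⊗ W`, where `(V ⊗ W)_g = ⨁ x y = g, V_x ⊗ W_y`. -/
noncomputable def tensorProj (V W : GradedVec ω) (g : G) :
    V.carrier ⊗[ℂ] W.carrier →ₗ[ℂ] V.carrier ⊗[ℂ] W.carrier :=
  ∑ x : G, TensorProduct.map (V.proj x) (W.proj (x⁻¹ * g))

lemma tensorProj_eq {V W : GradedVec ω} {x y : G} {v : V.carrier} {w : W.carrier}
    (hv : V.IsDeg x v) (hw : W.IsDeg y w) : tensorProj V W (x * y) (v ⊗ₜ w) = v ⊗ₜ w := by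
  rw [tensorProj, LinearMap.sum_apply, Finset.sum_eq_single x]
  · rw [TensorProduct.map_tmul, show V.proj x v = v from hv, inv_mul_cancel_left,
      show W.proj y w = w from hw]
  · intro z _ hz
    rw [TensorProduct.map_tmul, hv.ne hz, TensorProduct.zero_tmul]
  · simp

lemma tensorProj_ne {V W : GradedVec ω} {x y g : G} {v : V.carrier} {w : W.carrier}
    (hv : V.IsDeg x v) (hw : W.IsDeg y w) (hg : g ≠ x * y) :
    tensorProj V W g (v ⊗ₜ w) = 0 := by
  rw [tensorProj, LinearMap.sum_apply, Finset.sum_eq_zero]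
  intro z _
  rw [TensorProduct.map_tmul]
  by_cases hz : z = x
  · subst hz
    rw [hw.ne (by rintro rfl; exact hg (by group)), TensorProduct.tmul_zero]
  · rw [hv.ne hz, TensorProduct.zero_tmul]

lemma tensor_congr {V W : GradedVec ω}
    {f f' : V.carrier ⊗[ℂ] W.carrier →ₗ[ℂ] V.carrier ⊗[ℂ] W.carrier} (h : f = f') (t) :
    f t = f' t := by rw [h]

/-- The tensor product of graded vector spaces. -/
noncomputable abbrev tensor (V W : GradedVec ω) : GradedVec ω where
  carrier := V.carrier ⊗[ℂ] W.carrier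
  proj := tensorProj V W
  proj_self g t := by
    refine tensor_congr (f := tensorProj V W g ∘ₗ tensorProj V W g)
      (lin_ext₂ fun x y v w hv hw => ?_) t
    by_cases hg : g = x * y
    · subst hg; simp [tensorProj_eq hv hw]
    · simp [tensorProj_ne hv hw hg]
  proj_ne g h t hgh := by
    refine tensor_congr (f := tensorProj V W g ∘ₗ tensorProj V W h) (f' := 0)
      (lin_ext₂ fun x y v w hv hw => ?_) t
    by_cases hg : h = x * y
    · subst hg; simp [tensorProj_eq hv hw, tensorProj_ne hv hw hgh]
    · simp [tensorProj_ne hv hw hg]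
  sum_proj t := by
    rw [← LinearMap.sum_apply]
    refine tensor_congr (f' := LinearMap.id) (lin_ext₂ fun x y v w hv hw => ?_) t
    rw [LinearMap.sum_apply, Finset.sum_eq_single (x * y)]
    · exact tensorProj_eq hv hw
    · intro g _ hg; exact tensorProj_ne hv hw hg
    · simp

lemma IsDeg.tmul {V W : GradedVec ω} {x y : G} {v : V.carrier} {w : W.carrier}
    (hv : V.IsDeg x v) (hw : W.IsDeg y w) : (tensor V W).IsDeg (x * y) (v ⊗ₜ[ℂ] w) :=
  tensorProj_eq hv hw

/-- A linear map that sends homogeneous vectors to homogeneous vectors of the same degree. -/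
lemma comm_of_isDeg {V W : GradedVec ω} (f : V.carrier →ₗ[ℂ] W.carrier)
    (h : ∀ x v, V.IsDeg x v → W.IsDeg x (f v)) (g : G) (v : V.carrier) :
    f (V.proj g v) = W.proj g (f v) := by
  have : f ∘ₗ V.proj g = W.proj g ∘ₗ f := by
    refine lin_ext fun x v hv => ?_
    by_cases hg : g = x
    · subst hg
      rw [LinearMap.comp_apply, LinearMap.comp_apply, show V.proj g v = v from hv]
      exact (h g v hv).symm
    · rw [LinearMap.comp_apply, LinearMap.comp_apply, hv.ne hg, (h x v hv).ne hg, map_zero]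
  exact LinearMap.congr_fun this v

/-- The tensor product of morphisms is the tensor product of linear maps. -/
noncomputable def tensorMap {V W V' W' : GradedVec ω} (f : V ⟶ V') (g : W ⟶ W') :
    tensor V W ⟶ tensor V' W' where
  toLin := TensorProduct.map (Hom.toLin f) (Hom.toLin g)
  comm a t := by
    have : TensorProduct.map (Hom.toLin f) (Hom.toLin g) ∘ₗ tensorProj V W a =
        tensorProj V' W' a ∘ₗ TensorProduct.map (Hom.toLin f) (Hom.toLin g) := by
      refine lin_ext₂ fun x y v w hv hw => ?_
      rw [LinearMap.comp_apply, LinearMap.comp_apply, TensorProduct.map_tmul]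
      by_cases ha : a = x * y
      · subst ha
        rw [tensorProj_eq hv hw, tensorProj_eq (hv.map f) (hw.map g), TensorProduct.map_tmul]
      · rw [tensorProj_ne hv hw ha, tensorProj_ne (hv.map f) (hw.map g) ha, map_zero]
    exact LinearMap.congr_fun this t

open Classical in
/-- The unit object: `ℂ` in degree `1`. -/
noncomputable abbrev unit (ω : ThreeCocycle G) : GradedVec ω where
  carrier := ℂ
  proj g := if g = 1 then LinearMap.id else 0
  proj_self g v := by split_ifs <;> simp
  proj_ne g h v hgh := by
    by_cases hg : g = 1
    · subst hg; simp [hgh.symm]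
    · simp [hg]
  sum_proj v := by rw [Finset.sum_eq_single 1] <;> simp +contextual

lemma unit_isDeg (c : (unit ω).carrier) : (unit ω).IsDeg 1 c := by
  simp [IsDeg]

/-- The linear map `(u ⊗ v) ⊗ w ↦ ω(|u|, |v|, |w|) u ⊗ (v ⊗ w)`. -/
noncomputable def assocLin (U V W : GradedVec ω) :
    (U.carrier ⊗[ℂ] V.carrier) ⊗[ℂ] W.carrier →ₗ[ℂ] U.carrier ⊗[ℂ] (V.carrier ⊗[ℂ] W.carrier) :=
  ∑ x : G, ∑ y : G, ∑ z : G, (ω.val x y z : ℂ) •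
    ((TensorProduct.assoc ℂ U.carrier V.carrier W.carrier).toLinearMap ∘ₗ
      TensorProduct.map (TensorProduct.map (U.proj x) (V.proj y)) (W.proj z))

/-- The linear map `u ⊗ (v ⊗ w) ↦ ω(|u|, |v|, |w|)⁻¹ (u ⊗ v) ⊗ w`. -/
noncomputable def assocInvLin (U V W : GradedVec ω) :
    U.carrier ⊗[ℂ] (V.carrier ⊗[ℂ] W.carrier) →ₗ[ℂ] (U.carrier ⊗[ℂ] V.carrier) ⊗[ℂ] W.carrier :=
  ∑ x : G, ∑ y : G, ∑ z : G, (((ω.val x y z)⁻¹ : ℂˣ) : ℂ) •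
    ((TensorProduct.assoc ℂ U.carrier V.carrier W.carrier).symm.toLinearMap ∘ₗ
      TensorProduct.map (U.proj x) (TensorProduct.map (V.proj y) (W.proj z)))

lemma assocLin_tmul {U V W : GradedVec ω} {x y z : G} {u : U.carrier} {v : V.carrier}
    {w : W.carrier} (hu : U.IsDeg x u) (hv : V.IsDeg y v) (hw : W.IsDeg z w) :
    assocLin U V W ((u ⊗ₜ v) ⊗ₜ w) = (ω.val x y z : ℂ) • u ⊗ₜ[ℂ] (v ⊗ₜ[ℂ] w) := by
  simp only [assocLin, LinearMap.sum_apply, LinearMap.smul_apply, LinearMap.comp_apply,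
    TensorProduct.map_tmul, LinearEquiv.coe_coe, TensorProduct.assoc_tmul]
  rw [Finset.sum_eq_single x, Finset.sum_eq_single y, Finset.sum_eq_single z]
  · rw [show U.proj x u = u from hu, show V.proj y v = v from hv, show W.proj z w = w from hw]
  · intro c _ hc; simp [hw.ne hc]
  · simp
  · intro c _ hc; simp [hv.ne hc]
  · simp
  · intro c _ hc; simp [hu.ne hc]
  · simp

lemma assocInvLin_tmul {U V W : GradedVec ω} {x y z : G} {u : U.carrier} {v : V.carrier}
    {w : W.carrier} (hu : U.IsDeg x u) (hv : V.IsDeg y v) (hw : W.IsDeg z w) :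
    assocInvLin U V W (u ⊗ₜ (v ⊗ₜ w)) =
      (((ω.val x y z)⁻¹ : ℂˣ) : ℂ) • (u ⊗ₜ[ℂ] v) ⊗ₜ[ℂ] w := by
  simp only [assocInvLin, LinearMap.sum_apply, LinearMap.smul_apply, LinearMap.comp_apply,
    TensorProduct.map_tmul, LinearEquiv.coe_coe, TensorProduct.assoc_symm_tmul]
  rw [Finset.sum_eq_single x, Finset.sum_eq_single y, Finset.sum_eq_single z]
  · rw [show U.proj x u = u from hu, show V.proj y v = v from hv, show W.proj z w = w from hw]
  · intro c _ hc; simp [hw.ne hc]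
  · simp
  · intro c _ hc; simp [hv.ne hc]
  · simp
  · intro c _ hc; simp [hu.ne hc]
  · simp

lemma IsDeg.smul {V : GradedVec ω} {g : G} {v : V.carrier} (hv : V.IsDeg g v) (c : ℂ) :
    V.IsDeg g (c • v) := by
  unfold IsDeg; rw [map_smul, show V.proj g v = v from hv]

/-- A degree-preserving linear isomorphism is an isomorphism. -/
def isoMk {V W : GradedVec ω} (f : V ⟶ W) (g : W.carrier →ₗ[ℂ] V.carrier)
    (h₁ : g ∘ₗ Hom.toLin f = LinearMap.id) (h₂ : Hom.toLin f ∘ₗ g = LinearMap.id) : V ≅ W where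
  hom := f
  inv := ⟨g, fun a w => by
    have h : W.proj a w = Hom.toLin f (V.proj a (g w)) := by
      rw [Hom.comm]
      exact congrArg _ (LinearMap.congr_fun h₂ w).symm
    rw [h]
    exact LinearMap.congr_fun h₁ _⟩
  hom_inv_id := Hom.ext h₁
  inv_hom_id := Hom.ext h₂

/-- The associativity constraint of `Vect_G^ω`. -/
noncomputable def assocIso (U V W : GradedVec ω) :
    tensor (tensor U V) W ≅ tensor U (tensor V W) :=
  isoMk ⟨assocLin U V W, fun a t => by
      have : assocLin U V W ∘ₗ tensorProj (tensor U V) W a =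
          tensorProj U (tensor V W) a ∘ₗ assocLin U V W := by
        refine lin_ext₃ fun x y z u v w hu hv hw => ?_
        rw [LinearMap.comp_apply, LinearMap.comp_apply, assocLin_tmul hu hv hw, map_smul]
        by_cases ha : a = x * y * z
        · subst ha
          rw [tensorProj_eq (hu.tmul hv) hw, mul_assoc, tensorProj_eq hu (hv.tmul hw),
            assocLin_tmul hu hv hw]
        · rw [tensorProj_ne (hu.tmul hv) hw ha,
            tensorProj_ne hu (hv.tmul hw) (by rwa [← mul_assoc]), map_zero, smul_zero]
      exact LinearMap.congr_fun this t⟩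
    (assocInvLin U V W)
    (lin_ext₃ fun x y z u v w hu hv hw => by
      rw [LinearMap.comp_apply, LinearMap.id_apply]
      change assocInvLin U V W (assocLin U V W _) = _
      rw [assocLin_tmul hu hv hw, map_smul, assocInvLin_tmul hu hv hw, smul_smul, ← Units.val_mul,
        mul_inv_cancel, Units.val_one, one_smul])
    (lin_ext₃' fun x y z u v w hu hv hw => by
      rw [LinearMap.comp_apply, LinearMap.id_apply]
      change assocLin U V W (assocInvLin U V W _) = _
      rw [assocInvLin_tmul hu hv hw, map_smul, assocLin_tmul hu hv hw, smul_smul, ← Units.val_mul,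
        inv_mul_cancel, Units.val_one, one_smul])

/-- The left unit constraint `c ⊗ v ↦ c v`. -/
noncomputable def leftUnitIso (V : GradedVec ω) : tensor (unit ω) V ≅ V :=
  isoMk ⟨(TensorProduct.lid ℂ V.carrier).toLinearMap, fun a t => by
      have : (TensorProduct.lid ℂ V.carrier).toLinearMap ∘ₗ tensorProj (unit ω) V a =
          V.proj a ∘ₗ (TensorProduct.lid ℂ V.carrier).toLinearMap := by
        refine lin_ext₂ fun x y c v _ hv => ?_
        have hc := unit_isDeg c
        have e : (TensorProduct.lid ℂ V.carrier) (c ⊗ₜ v) = (show ℂ from c) • v :=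
          TensorProduct.lid_tmul _ _
        rw [LinearMap.comp_apply, LinearMap.comp_apply]
        by_cases ha : a = 1 * y
        · subst ha
          rw [tensorProj_eq hc hv, LinearEquiv.coe_coe, e, one_mul]
          exact (hv.smul _).symm
        · rw [tensorProj_ne hc hv ha, LinearEquiv.coe_coe, e, map_zero,
            (hv.smul _).ne (by rwa [one_mul] at ha)]
      exact LinearMap.congr_fun this t⟩
    (TensorProduct.lid ℂ V.carrier).symm.toLinearMap
    (LinearMap.ext fun t => (TensorProduct.lid ℂ V.carrier).symm_apply_apply t)
    (LinearMap.ext fun t => (TensorProduct.lid ℂ V.carrier).apply_symm_apply t)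

/-- The right unit constraint `v ⊗ c ↦ c v`. -/
noncomputable def rightUnitIso (V : GradedVec ω) : tensor V (unit ω) ≅ V :=
  isoMk ⟨(TensorProduct.rid ℂ V.carrier).toLinearMap, fun a t => by
      have : (TensorProduct.rid ℂ V.carrier).toLinearMap ∘ₗ tensorProj V (unit ω) a =
          V.proj a ∘ₗ (TensorProduct.rid ℂ V.carrier).toLinearMap := by
        refine lin_ext₂ fun x y v c hv _ => ?_
        have hc := unit_isDeg c
        have e : (TensorProduct.rid ℂ V.carrier) (v ⊗ₜ c) = (show ℂ from c) • v :=
          TensorProduct.rid_tmul _ _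
        rw [LinearMap.comp_apply, LinearMap.comp_apply]
        by_cases ha : a = x * 1
        · subst ha
          rw [tensorProj_eq hv hc, LinearEquiv.coe_coe, e, mul_one]
          exact (hv.smul _).symm
        · rw [tensorProj_ne hv hc ha, LinearEquiv.coe_coe, e, map_zero,
            (hv.smul _).ne (by rwa [mul_one] at ha)]
      exact LinearMap.congr_fun this t⟩
    (TensorProduct.rid ℂ V.carrier).symm.toLinearMap
    (LinearMap.ext fun t => (TensorProduct.rid ℂ V.carrier).symm_apply_apply t)
    (LinearMap.ext fun t => (TensorProduct.rid ℂ V.carrier).apply_symm_apply t)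

noncomputable instance : MonoidalCategoryStruct (GradedVec ω) where
  tensorObj := tensor
  tensorHom := tensorMap
  whiskerLeft V _ _ f := tensorMap (𝟙 V) f
  whiskerRight f W := tensorMap f (𝟙 W)
  tensorUnit := unit ω
  associator := assocIso
  leftUnitor := leftUnitIso
  rightUnitor := rightUnitIso

/-- The monoidal category `Vect_G^ω`. -/
noncomputable instance : MonoidalCategory (GradedVec ω) :=
  MonoidalCategory.ofTensorHom
    (id_tensorHom_id := fun V W => Hom.ext TensorProduct.map_id)
    (id_tensorHom := fun _ _ _ _ => rfl)
    (tensorHom_id := fun _ _ => rfl)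
    (tensorHom_comp_tensorHom := fun f₁ f₂ g₁ g₂ =>
      Hom.ext (TensorProduct.map_comp _ _ _ _).symm)
    (associator_naturality := fun {X₁ X₂ X₃ Y₁ Y₂ Y₃} f₁ f₂ f₃ => Hom.ext <|
      lin_ext₃ (U := X₁) (V := X₂) (W := X₃) fun x y z u v w hu hv hw => by
        let a : X₁.carrier ⊗[ℂ] (X₂.carrier ⊗[ℂ] X₃.carrier) →ₗ[ℂ]
            Y₁.carrier ⊗[ℂ] (Y₂.carrier ⊗[ℂ] Y₃.carrier) :=
          TensorProduct.map (Hom.toLin f₁) (TensorProduct.map (Hom.toLin f₂) (Hom.toLin f₃))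
        change assocLin Y₁ Y₂ Y₃ ((Hom.toLin f₁ u ⊗ₜ Hom.toLin f₂ v) ⊗ₜ Hom.toLin f₃ w) =
          a (assocLin X₁ X₂ X₃ ((u ⊗ₜ v) ⊗ₜ w))
        rw [assocLin_tmul (hu.map f₁) (hv.map f₂) (hw.map f₃), assocLin_tmul hu hv hw]
        exact (LinearMap.map_smul a (ω.val x y z : ℂ) (u ⊗ₜ[ℂ] (v ⊗ₜ[ℂ] w))).symm)
    (leftUnitor_naturality := fun {X Y} f => Hom.ext <|
      TensorProduct.ext' fun c v => by
        change (show ℂ from c) • Hom.toLin f v = Hom.toLin f ((show ℂ from c) • v)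
        rw [map_smul])
    (rightUnitor_naturality := fun {X Y} f => Hom.ext <|
      TensorProduct.ext' fun v c => by
        change (show ℂ from c) • Hom.toLin f v = Hom.toLin f ((show ℂ from c) • v)
        rw [map_smul])
    (pentagon := fun T U V W => Hom.ext <|
      lin_ext₄ (T := T) (U := U) (V := V) (W := W) fun r x y z t u v w ht hu hv hw => by
        have h₁ : assocLin T U V ((t ⊗ₜ u) ⊗ₜ v) ⊗ₜ[ℂ] w =
            (ω.val r x y : ℂ) • ((t ⊗ₜ[ℂ] (u ⊗ₜ[ℂ] v)) ⊗ₜ[ℂ] w) := by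
          rw [assocLin_tmul ht hu hv]; rfl
        have h₂ := assocLin_tmul ht (hu.tmul hv) hw
        have h₃ : t ⊗ₜ[ℂ] assocLin U V W ((u ⊗ₜ v) ⊗ₜ w) =
            (ω.val x y z : ℂ) • (t ⊗ₜ[ℂ] (u ⊗ₜ[ℂ] (v ⊗ₜ[ℂ] w))) := by
          rw [assocLin_tmul hu hv hw, TensorProduct.tmul_smul]
        have h₄ := assocLin_tmul (ht.tmul hu) hv hw
        have h₅ := assocLin_tmul ht hu (hv.tmul hw)
        let a : T.carrier ⊗[ℂ] ((U.carrier ⊗[ℂ] V.carrier) ⊗[ℂ] W.carrier) →ₗ[ℂ]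
            T.carrier ⊗[ℂ] (U.carrier ⊗[ℂ] (V.carrier ⊗[ℂ] W.carrier)) :=
          TensorProduct.map LinearMap.id (assocLin U V W)
        change a (assocLin T (tensor U V) W (assocLin T U V ((t ⊗ₜ u) ⊗ₜ v) ⊗ₜ w)) =
          assocLin T U (tensor V W) (assocLin (tensor T U) V W (((t ⊗ₜ u) ⊗ₜ v) ⊗ₜ w))
        refine (congrArg (fun s => a (assocLin T (tensor U V) W s)) h₁).trans ?_
        refine (congrArg a (LinearMap.map_smul (assocLin T (tensor U V) W) _ _)).trans ?_
        refine (congrArg (fun s => a ((ω.val r x y : ℂ) • s)) h₂).trans ?_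
        refine Eq.trans ?_ (congrArg (assocLin T U (tensor V W)) h₄).symm
        refine Eq.trans ?_ (LinearMap.map_smul (assocLin T U (tensor V W)) _ _).symm
        refine Eq.trans ?_ (congrArg (fun s => (ω.val (r * x) y z : ℂ) • s) h₅).symm
        refine (LinearMap.map_smul a _ _).trans ?_
        refine (congrArg (fun s => (ω.val r x y : ℂ) • s) (LinearMap.map_smul a _ _)).trans ?_
        refine (congrArg (fun s => (ω.val r x y : ℂ) • (ω.val r (x * y) z : ℂ) • s) h₃).trans ?_
        rw [smul_smul, smul_smul, smul_smul, ← Units.val_mul, ← Units.val_mul, ← Units.val_mul,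
          ω.cocycle])
    (triangle := fun V W => Hom.ext <|
      lin_ext₃ (U := V) (V := unit ω) (W := W) fun x y z v c w hv _ hw => by
        change Hom.toLin (tensorMap (𝟙 V) (leftUnitIso W).hom)
            (assocLin V (unit ω) W ((v ⊗ₜ c) ⊗ₜ w)) =
          ((show ℂ from c) • v) ⊗ₜ[ℂ] w
        rw [assocLin_tmul hv (unit_isDeg c) hw, ω.one_mid, Units.val_one, one_smul,
          TensorProduct.smul_tmul]
        rfl)

end GradedVec

/-! ### The Drinfeld center of `Vect_G^ω` -/

/-- The (right) Drinfeld center of `Vect_G^ω`. An object of Mathlib's `Center` carries a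
half-braiding `β_V : W ⊗ V ≅ V ⊗ W`; the right half-braiding is its inverse
`σ_{V, W} = β_V⁻¹ : V ⊗ W ≅ W ⊗ V`. So the right center is the same monoidal category with the
reverse braiding. -/
def TwistedDouble (ω : ThreeCocycle G) : Type 1 := Center (GradedVec ω)

namespace TwistedDouble

variable {ω : ThreeCocycle G}

instance : Category (TwistedDouble ω) := inferInstanceAs (Category (Center (GradedVec ω)))

noncomputable instance : MonoidalCategory (TwistedDouble ω) :=
  inferInstanceAs (MonoidalCategory (Center (GradedVec ω)))

noncomputable instance : BraidedCategory (TwistedDouble ω) :=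
  reverseBraiding (Center (GradedVec ω))

/-- The underlying linear map of a morphism in the center. -/
def toLin {X Y : TwistedDouble ω} (f : X ⟶ Y) : X.1.carrier →ₗ[ℂ] Y.1.carrier :=
  GradedVec.Hom.toLin (Center.Hom.f f)

/-- The underlying morphism is zero. -/
instance : Limits.HasZeroMorphisms (TwistedDouble ω) where
  zero X Y := ⟨{
    f := 0
    comm := fun U => by
      have h₁ : (0 : X.1 ⟶ Y.1) ▷ U = 0 :=
        GradedVec.Hom.ext (TensorProduct.map_zero_left _)
      have h₂ : U ◁ (0 : X.1 ⟶ Y.1) = 0 :=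
        GradedVec.Hom.ext (TensorProduct.map_zero_right _)
      rw [h₁, h₂, Limits.zero_comp, Limits.comp_zero] }⟩
  comp_zero {X Y} f Z := Center.ext _ _ (Limits.comp_zero (f := Center.Hom.f f) (Z := Z.1))
  zero_comp X {Y Z} f := Center.ext _ _ (Limits.zero_comp (X := X.1) (f := Center.Hom.f f))

/-- The simple objects of the center. -/
abbrev SimpleObj (ω : ThreeCocycle G) : Type 1 := {X : TwistedDouble ω // Simple X}

/-- The pivotal trace of an endomorphism. For the canonical pivotal structure, the one whose
pivotal dimensions are the vector space dimensions, this is the trace of the underlying linear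
map. -/
noncomputable def ptr {X : TwistedDouble ω} (f : X ⟶ X) : ℂ :=
  LinearMap.trace ℂ X.1.carrier (toLin f)

/-- The `T`-matrix, that is the twist `θ_X` of a simple object. The closure of the braid
`σ ∈ 𝔹₂` is an unknot with a kink, so `ptr σ_{X, X} = θ_X dim X`. -/
noncomputable def T (X : SimpleObj ω) : ℂ :=
  ptr (β_ X.1 X.1).hom / Module.finrank ℂ X.1.1.carrier

/-- The braid `σ₂⁻¹ σ₁` (first `σ₁`, then `σ₂⁻¹`) on three strands coloured `X, Y, Z`. -/
noncomputable def braidStep (X Y Z : TwistedDouble ω) : (X ⊗ Y) ⊗ Z ⟶ (Y ⊗ Z) ⊗ X :=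
  (β_ X Y).hom ▷ Z ≫ (α_ Y X Z).hom ≫ Y ◁ (β_ Z X).inv ≫ (α_ Y Z X).inv

/-- The borromean tensor, `B_{XYZ} = ptr ((σ₂⁻¹ σ₁)³)`. -/
noncomputable def B (X Y Z : SimpleObj ω) : ℂ :=
  ptr (braidStep X.1 Y.1 Z.1 ≫ braidStep Y.1 Z.1 X.1 ≫ braidStep Z.1 X.1 Y.1)

end TwistedDouble

end TwistedDoubles

/-! ### The groups of order `pq` -/

/-- The semidirect product `ℤ/q ⋊ ℤ/p` for an action `φ` of `ℤ/p` on `ℤ/q`. -/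
abbrev PQGroup (p q : ℕ) (φ : Multiplicative (ZMod p) →* MulAut (Multiplicative (ZMod q))) : Type :=
  Multiplicative (ZMod q) ⋊[φ] Multiplicative (ZMod p)

instance (p q : ℕ) [NeZero p] [NeZero q]
    (φ : Multiplicative (ZMod p) →* MulAut (Multiplicative (ZMod q))) : Fintype (PQGroup p q φ) :=
  Fintype.ofEquiv _ SemidirectProduct.equivProd.symm

/-- The cocycle `ω^u` on `ℤ/q ⋊ ℤ/p`: the `u`-th power of the inflation of the standard generator
of `H³(ℤ/p, ℂˣ)`. -/
noncomputable def pqCocycle (p q : ℕ) [NeZero p]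
    (φ : Multiplicative (ZMod p) →* MulAut (Multiplicative (ZMod q))) (u : ℕ) :
    ThreeCocycle (PQGroup p q φ) :=
  ((ThreeCocycle.standard p).inflate SemidirectProduct.rightHom).pow u

/-! Only the forward implication has content; for `u = u'` the identity works. An object of the
center is a `G`-graded space with operators `act g` that carry degree `h` to degree `g h g⁻¹` and
multiply up to the scalar `phase`. The braiding is `x ⊗ y ↦ act |x| y ⊗ x`. Hence the twist is `x ↦
act |x| x`, which is a scalar on a simple object by Schur's lemma (`twist_eq_smul`), and the
borromean braid is a composite of operators `act` and `rho`.

The twist sees `u` only up to a square. If a simple object lives over `i ≠ 0` in `ℤ/p`, its degrees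
satisfy `g ^ p = 1`, and `T ^ p = exp (-2πi u i² / p)` (`T_pow`). Take `X` over `i = 1` with `T X ≠
1`. Its image `κ X` lies over some `i' ≠ 0`, since objects over `0` have twists of order dividing
`q`, whereas the order of `T X` divides `p²`. Comparing twists gives `u = u' i'²` modulo `p`, so it
remains to show `i' = ±1`.

The borromean tensor supplies this. Let `Y` have twist `exp (2πi / q)`. Such an object is a flux
(`exists_isFlux`): its degrees form one orbit in `ℤ/q`, and the normal subgroup acts by scalars.
Therefore `κ Y` is a flux as well, possibly for another orbit. Let `N` be the character by which
`ℤ/p` acts on `ℤ/q`, and `ψ` the standard additive character of `ℤ/q`. By `B_flux`, `B X Y Y` is a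
positive integer times the sum over `z` of `ψ ((N (-i) - 1) N (-z) + (N i - 1) N z)`, whatever the
orbit is. With `i = 2x` and a shift of `z`, the argument of `ψ` factors as `(N x - N (-x)) (N z - N
(-z))`.

Since `2p < q`, the rational linear relations among `q`-th roots of unity are too few to hide the
set of exponents, even up to a positive factor. The sum of the squares of the exponents is `-2p (N x
- N (-x))²`, which determines `x` up to sign, hence `i` up to sign
(`FaithfulChar.eq_or_eq_neg_of_sum_eq`). -/

/-! ### Objects of the center as graded spaces with a twisted action. -/

section CenterAction

variable {G : Type} [Group G] [Fintype G] {ω : ThreeCocycle G}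

namespace GradedVec

open Classical in
/-- The one-dimensional object concentrated in degree `g`. -/
noncomputable abbrev pt (ω : ThreeCocycle G) (g : G) : GradedVec ω where
  carrier := ℂ
  proj h := if h = g then LinearMap.id else 0
  proj_self h v := by split_ifs <;> simp
  proj_ne h k v hk := by
    by_cases hg : h = g
    · subst hg; simp [hk.symm]
    · simp [hg]
  sum_proj v := by rw [Finset.sum_eq_single g] <;> simp +contextual

lemma pt_isDeg (g : G) (c : (pt ω g).carrier) : (pt ω g).IsDeg g c := by
  simp [IsDeg]

/-- The morphism out of `pt g` that picks a homogeneous vector. -/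
noncomputable def ptHom {W : GradedVec ω} {g : G} {w : W.carrier} (hw : W.IsDeg g w) :
    pt ω g ⟶ W where
  toLin := LinearMap.toSpanSingleton ℂ W.carrier w
  comm := comm_of_isDeg (V := pt ω g) _ fun x v hv => by
    by_cases hx : x = g
    · subst hx
      exact hw.smul _
    · have h0 : v = 0 := by
        have : (pt ω g).proj x v = v := hv
        rwa [(pt_isDeg g v).ne hx, eq_comm] at this
      subst h0
      rw [map_zero]
      exact map_zero _

lemma ptHom_one {W : GradedVec ω} {g : G} {w : W.carrier} (hw : W.IsDeg g w) :
    Hom.toLin (ptHom hw) (1 : ℂ) = w := one_smul _ _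

end GradedVec

open GradedVec

namespace TwistedDouble

variable (X : TwistedDouble ω)

/-- The half-braiding with `W` as a linear map. -/
noncomputable def halfLin (W : GradedVec ω) :
    X.1.carrier ⊗[ℂ] W.carrier →ₗ[ℂ] W.carrier ⊗[ℂ] X.1.carrier :=
  Hom.toLin (X.2.β W).hom

/-- The inverse half-braiding with `W` as a linear map. -/
noncomputable def halfInvLin (W : GradedVec ω) :
    W.carrier ⊗[ℂ] X.1.carrier →ₗ[ℂ] X.1.carrier ⊗[ℂ] W.carrier :=
  Hom.toLin (X.2.β W).inv

lemma halfInvLin_halfLin (W : GradedVec ω) (t) : X.halfInvLin W (X.halfLin W t) = t :=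
  LinearMap.congr_fun (congrArg Hom.toLin (X.2.β W).hom_inv_id) t

lemma halfLin_halfInvLin (W : GradedVec ω) (t) : X.halfLin W (X.halfInvLin W t) = t :=
  LinearMap.congr_fun (congrArg Hom.toLin (X.2.β W).inv_hom_id) t

/-- The operator `ρ g` with `x ⊗ 1 ↦ 1 ⊗ ρ g x` under the half-braiding with `pt g`. -/
noncomputable def rho (g : G) : X.1.carrier →ₗ[ℂ] X.1.carrier :=
  (TensorProduct.lid ℂ X.1.carrier).toLinearMap ∘ₗ X.halfLin (pt ω g) ∘ₗ
    (TensorProduct.rid ℂ X.1.carrier).symm.toLinearMap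

/-- The inverse of `ρ g`: the twisted action of `g` on an object of the center. -/
noncomputable def act (g : G) : X.1.carrier →ₗ[ℂ] X.1.carrier :=
  (TensorProduct.rid ℂ X.1.carrier).toLinearMap ∘ₗ X.halfInvLin (pt ω g) ∘ₗ
    (TensorProduct.lid ℂ X.1.carrier).symm.toLinearMap

lemma halfLin_pt (g : G) (x : X.1.carrier) :
    X.halfLin (pt ω g) (x ⊗ₜ[ℂ] (1 : ℂ)) = (1 : ℂ) ⊗ₜ[ℂ] X.rho g x :=
  ((TensorProduct.lid ℂ X.1.carrier).symm_apply_apply _).symm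

lemma halfInvLin_pt (g : G) (x : X.1.carrier) :
    X.halfInvLin (pt ω g) ((1 : ℂ) ⊗ₜ[ℂ] x) = X.act g x ⊗ₜ[ℂ] (1 : ℂ) :=
  ((TensorProduct.rid ℂ X.1.carrier).symm_apply_apply _).symm

/-- Naturality along `ptHom`: the half-braiding with any `W` is determined by those with the
one-dimensional objects `pt ω g`. -/
lemma halfLin_tmul {W : GradedVec ω} {g : G} {w : W.carrier} (hw : W.IsDeg g w)
    (x : X.1.carrier) : X.halfLin W (x ⊗ₜ[ℂ] w) = w ⊗ₜ[ℂ] X.rho g x := by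
  have h := LinearMap.congr_fun (congrArg Hom.toLin (X.2.naturality (ptHom hw)))
    (x ⊗ₜ[ℂ] (1 : ℂ))
  change X.halfLin W (x ⊗ₜ[ℂ] Hom.toLin (ptHom hw) (1 : ℂ)) =
    TensorProduct.map (Hom.toLin (ptHom hw)) LinearMap.id
      (X.halfLin (pt ω g) (x ⊗ₜ[ℂ] (1 : ℂ))) at h
  rw [halfLin_pt, TensorProduct.map_tmul, ptHom_one] at h
  exact h

lemma rho_act (g : G) (x : X.1.carrier) : X.rho g (X.act g x) = x := by
  have h := X.halfLin_halfInvLin (pt ω g) ((1 : ℂ) ⊗ₜ[ℂ] x)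
  rw [halfInvLin_pt, halfLin_pt] at h
  simpa using congrArg (TensorProduct.lid ℂ X.1.carrier) h

lemma act_rho (g : G) (x : X.1.carrier) : X.act g (X.rho g x) = x := by
  have h := X.halfInvLin_halfLin (pt ω g) (x ⊗ₜ[ℂ] (1 : ℂ))
  rw [halfLin_pt, halfInvLin_pt] at h
  simpa using congrArg (TensorProduct.rid ℂ X.1.carrier) h

lemma halfInvLin_tmul {W : GradedVec ω} {g : G} {w : W.carrier} (hw : W.IsDeg g w)
    (x : X.1.carrier) : X.halfInvLin W (w ⊗ₜ[ℂ] x) = X.act g x ⊗ₜ[ℂ] w := by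
  rw [← X.halfInvLin_halfLin W (X.act g x ⊗ₜ[ℂ] w), X.halfLin_tmul hw, rho_act]

variable {X}

lemma _root_.GradedVec.IsDeg.of_tmul_one {V : GradedVec ω} {g h : G} {v : V.carrier}
    (hv : (tensor V (pt ω g)).IsDeg (h * g) (v ⊗ₜ[ℂ] (1 : ℂ))) : V.IsDeg h v := by
  have h1 : tensorProj V (pt ω g) (h * g) (v ⊗ₜ[ℂ] (1 : ℂ)) = V.proj h v ⊗ₜ[ℂ] (1 : ℂ) := by
    rw [tensorProj, LinearMap.sum_apply, Finset.sum_eq_single h]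
    · simp
    · intro z _ hz
      have : z⁻¹ * (h * g) ≠ g := by
        intro e
        apply hz
        have := mul_right_cancel ((mul_assoc z⁻¹ h g).trans (e.trans (one_mul g).symm))
        exact (inv_mul_eq_one.mp this)
      rw [TensorProduct.map_tmul, (pt_isDeg g (1 : ℂ)).ne this, TensorProduct.tmul_zero]
    · simp
  have h2 : V.proj h v ⊗ₜ[ℂ] (1 : ℂ) = v ⊗ₜ[ℂ] (1 : ℂ) := h1.symm.trans hv
  have h3 := congrArg (TensorProduct.rid ℂ V.carrier) h2
  simp only [TensorProduct.rid_tmul, one_smul] at h3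
  exact h3

/-- The half-braiding preserves the total degree `g h`, and the factor `pt ω g` still carries `g`,
now on the right. -/
lemma isDeg_act (g : G) {h : G} {x : X.1.carrier} (hx : X.1.IsDeg h x) :
    X.1.IsDeg (g * h * g⁻¹) (X.act g x) := by
  have h1 := ((pt_isDeg (ω := ω) g (1 : ℂ)).tmul hx).map (X.2.β (pt ω g)).inv
  change (tensor X.1 (pt ω g)).IsDeg (g * h) (X.halfInvLin (pt ω g) ((1 : ℂ) ⊗ₜ[ℂ] x)) at h1
  rw [halfInvLin_pt] at h1
  apply GradedVec.IsDeg.of_tmul_one (g := g)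
  rwa [inv_mul_cancel_right]

lemma act_injective (g : G) : Function.Injective (X.act g) :=
  Function.LeftInverse.injective (X.rho_act g)

lemma rho_injective (g : G) : Function.Injective (X.rho g) :=
  Function.LeftInverse.injective (X.act_rho g)

lemma act_proj (g h : G) (x : X.1.carrier) :
    X.act g (X.1.proj h x) = X.1.proj (g * h * g⁻¹) (X.act g x) := by
  have : X.act g ∘ₗ X.1.proj h = X.1.proj (g * h * g⁻¹) ∘ₗ X.act g := by
    refine lin_ext fun k v hv => ?_
    rw [LinearMap.comp_apply, LinearMap.comp_apply]
    by_cases hk : h = k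
    · subst hk
      rw [show X.1.proj h v = v from hv]
      exact (isDeg_act g hv).symm
    · rw [hv.ne hk, (isDeg_act g hv).ne (by simpa using hk), map_zero]
  exact LinearMap.congr_fun this x

lemma rho_proj (g h : G) (x : X.1.carrier) :
    X.rho g (X.1.proj h x) = X.1.proj (g⁻¹ * h * g) (X.rho g x) := by
  apply act_injective g
  rw [act_rho, act_proj, act_rho]
  congr 2
  group

lemma isDeg_rho (g : G) {h : G} {x : X.1.carrier} (hx : X.1.IsDeg h x) :
    X.1.IsDeg (g⁻¹ * h * g) (X.rho g x) := by
  unfold IsDeg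
  rw [← rho_proj, show X.1.proj h x = x from hx]

/-- The cocycle that controls the action on the component of degree `k`. -/
noncomputable def phase (ω : ThreeCocycle G) (k g g' : G) : ℂˣ :=
  (ω.val (g * g' * k * (g * g')⁻¹) g g')⁻¹ * ω.val g (g' * k * g'⁻¹) g' * (ω.val g g' k)⁻¹

/-- This is the `monoidal` axiom of the half-braiding evaluated on `x ⊗ (1 ⊗ 1)`. Its three
associators contribute the three factors of `phase`. -/
lemma rho_rho (g g' : G) {h k : G} (hk : g * g' * k = h * (g * g')) {x : X.1.carrier}
    (hx : X.1.IsDeg h x) :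
    X.rho (g * g') x = (phase ω k g g' : ℂ) • X.rho g' (X.rho g x) := by
  have h1 := LinearMap.congr_fun (congrArg Hom.toLin (X.2.monoidal (pt ω g) (pt ω g')))
    (x ⊗ₜ[ℂ] ((1 : ℂ) ⊗ₜ[ℂ] (1 : ℂ)))
  have hk' : h = g * g' * k * (g * g')⁻¹ := by rw [hk]; group
  change X.halfLin (tensor (pt ω g) (pt ω g')) (x ⊗ₜ[ℂ] ((1 : ℂ) ⊗ₜ[ℂ] (1 : ℂ))) =
    assocInvLin (pt ω g) (pt ω g') X.1 (TensorProduct.map LinearMap.id (X.halfLin (pt ω g'))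
      (assocLin (pt ω g) X.1 (pt ω g') (TensorProduct.map (X.halfLin (pt ω g)) LinearMap.id
        (assocInvLin X.1 (pt ω g) (pt ω g') (x ⊗ₜ[ℂ] ((1 : ℂ) ⊗ₜ[ℂ] (1 : ℂ))))))) at h1
  have d1 : X.1.IsDeg (g' * k * g'⁻¹) (X.rho g x) := by
    have := isDeg_rho g hx
    rwa [hk', show g⁻¹ * (g * g' * k * (g * g')⁻¹) * g = g' * k * g'⁻¹ by group] at this
  have d2 : X.1.IsDeg k (X.rho g' (X.rho g x)) := by
    have := isDeg_rho g' d1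
    rwa [show g'⁻¹ * (g' * k * g'⁻¹) * g' = k by group] at this
  have e1 := assocInvLin_tmul hx (pt_isDeg (ω := ω) g (1 : ℂ)) (pt_isDeg (ω := ω) g' (1 : ℂ))
  have e2 := assocLin_tmul (pt_isDeg (ω := ω) g (1 : ℂ)) d1 (pt_isDeg (ω := ω) g' (1 : ℂ))
  have e3 := assocInvLin_tmul (pt_isDeg (ω := ω) g (1 : ℂ)) (pt_isDeg (ω := ω) g' (1 : ℂ)) d2
  rw [halfLin_tmul X ((pt_isDeg (ω := ω) g (1 : ℂ)).tmul (pt_isDeg (ω := ω) g' (1 : ℂ)))] at h1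
  rw [e1, map_smul, map_smul, map_smul, map_smul, TensorProduct.map_tmul, halfLin_pt,
    LinearMap.id_apply, e2, map_smul, map_smul, TensorProduct.map_tmul, halfLin_pt,
    LinearMap.id_apply, e3] at h1
  have h2 := congrArg ((TensorProduct.lid ℂ X.1.carrier).toLinearMap ∘ₗ
    (TensorProduct.map (TensorProduct.lid ℂ ℂ).toLinearMap LinearMap.id)) h1
  simp only [map_smul, LinearMap.comp_apply, TensorProduct.map_tmul, LinearEquiv.coe_coe,
    TensorProduct.lid_tmul, one_smul, LinearMap.id_apply, smul_smul] at h2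
  rw [h2, phase, ← hk', Units.val_mul, Units.val_mul, mul_assoc (_ : ℂ)]

lemma act_act (g g' : G) {k : G} {y : X.1.carrier} (hy : X.1.IsDeg k y) :
    X.act g (X.act g' y) = (phase ω k g g' : ℂ) • X.act (g * g') y := by
  apply rho_injective (g * g')
  have hd : X.1.IsDeg (g * g' * k * (g * g')⁻¹) (X.act g (X.act g' y)) := by
    have := isDeg_act g (isDeg_act g' hy)
    rwa [show g * (g' * k * g'⁻¹) * g⁻¹ = g * g' * k * (g * g')⁻¹ by group] at this
  rw [rho_rho g g' (k := k) (by group) hd, map_smul, rho_act, rho_act, rho_act]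

/-- Normalization of the cocycle makes the phase at `(1, 1)` trivial, so `act 1` is an injective
idempotent. -/
lemma act_one (y : X.1.carrier) : X.act 1 y = y := by
  have : X.act 1 = LinearMap.id := lin_ext fun k v hv => by
    apply act_injective 1
    rw [act_act 1 1 hv]
    simp [phase, ω.one_left, ω.one_mid]
  rw [this, LinearMap.id_apply]

/-! ### Morphisms and subobjects -/

lemma hom_ext {X Y : TwistedDouble ω} {f g : X ⟶ Y} (h : ∀ x, toLin f x = toLin g x) : f = g :=
  Center.ext _ _ (GradedVec.hom_ext _ _ h)

lemma toLin_proj {X Y : TwistedDouble ω} (f : X ⟶ Y) (g : G) (x : X.1.carrier) :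
    toLin f (X.1.proj g x) = Y.1.proj g (toLin f x) :=
  Hom.comm (Center.Hom.f f) g x

lemma toLin_rho {X Y : TwistedDouble ω} (f : X ⟶ Y) (g : G) (x : X.1.carrier) :
    toLin f (X.rho g x) = Y.rho g (toLin f x) := by
  have h := LinearMap.congr_fun (congrArg Hom.toLin (Center.Hom.comm f (pt ω g)))
    (x ⊗ₜ[ℂ] (1 : ℂ))
  change Y.halfLin (pt ω g) (toLin f x ⊗ₜ[ℂ] (1 : ℂ)) =
    TensorProduct.map LinearMap.id (toLin f) (X.halfLin (pt ω g) (x ⊗ₜ[ℂ] (1 : ℂ))) at h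
  rw [halfLin_pt, halfLin_pt, TensorProduct.map_tmul] at h
  have h1 := congrArg (TensorProduct.lid ℂ Y.1.carrier) h
  simp only [LinearMap.id_apply, TensorProduct.lid_tmul, one_smul] at h1
  exact h1.symm

lemma toLin_act {X Y : TwistedDouble ω} (f : X ⟶ Y) (g : G) (x : X.1.carrier) :
    toLin f (X.act g x) = Y.act g (toLin f x) := by
  apply rho_injective g
  rw [← toLin_rho, rho_act, rho_act]

/-- A degree-preserving linear map that commutes with the twisted actions. -/
noncomputable def homMk {X Y : TwistedDouble ω} (f : X.1 ⟶ Y.1)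
    (hf : ∀ g x, Hom.toLin f (X.rho g x) = Y.rho g (Hom.toLin f x)) : X ⟶ Y :=
  ⟨f, fun W => Hom.ext <| lin_ext₂ (V := X.1) (W := W) fun x y v w hv hw => by
    change Y.halfLin W (Hom.toLin f v ⊗ₜ[ℂ] w) =
      TensorProduct.map LinearMap.id (Hom.toLin f) (X.halfLin W (v ⊗ₜ[ℂ] w))
    rw [halfLin_tmul _ hw, halfLin_tmul _ hw, TensorProduct.map_tmul, hf]
    rfl⟩

end TwistedDouble

/-! ### Reconstruction of an object of the center from a twisted action. -/

/-- A graded vector space with a twisted action of `G`, compatible with the grading. -/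
structure TwistedAction (ω : ThreeCocycle G) (V : GradedVec ω) where
  act : G → V.carrier →ₗ[ℂ] V.carrier
  rho : G → V.carrier →ₗ[ℂ] V.carrier
  act_rho : ∀ g x, act g (rho g x) = x
  rho_act : ∀ g x, rho g (act g x) = x
  isDeg_rho : ∀ g h x, V.IsDeg h x → V.IsDeg (g⁻¹ * h * g) (rho g x)
  act_act : ∀ g g' k x, V.IsDeg k x →
    act g (act g' x) = (TwistedDouble.phase ω k g g' : ℂ) • act (g * g') x

namespace TwistedAction

variable {V : GradedVec ω} (A : TwistedAction ω V)

/-- `x ⊗ w ↦ w ⊗ ρ |w| x` -/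
noncomputable def halfLin (W : GradedVec ω) :
    V.carrier ⊗[ℂ] W.carrier →ₗ[ℂ] W.carrier ⊗[ℂ] V.carrier :=
  ∑ g : G, TensorProduct.map (W.proj g) (A.rho g) ∘ₗ
    (TensorProduct.comm ℂ V.carrier W.carrier).toLinearMap

/-- `w ⊗ x ↦ act |w| x ⊗ w` -/
noncomputable def halfInvLin (W : GradedVec ω) :
    W.carrier ⊗[ℂ] V.carrier →ₗ[ℂ] V.carrier ⊗[ℂ] W.carrier :=
  ∑ g : G, TensorProduct.map (A.act g) (W.proj g) ∘ₗ
    (TensorProduct.comm ℂ W.carrier V.carrier).toLinearMap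

lemma halfLin_tmul {W : GradedVec ω} {g : G} {w : W.carrier} (hw : W.IsDeg g w)
    (x : V.carrier) : A.halfLin W (x ⊗ₜ[ℂ] w) = w ⊗ₜ[ℂ] A.rho g x := by
  rw [halfLin, LinearMap.sum_apply, Finset.sum_eq_single g]
  · simp [show W.proj g w = w from hw]
  · intro k _ hk
    simp [hw.ne hk]
  · simp

lemma halfInvLin_tmul {W : GradedVec ω} {g : G} {w : W.carrier} (hw : W.IsDeg g w)
    (x : V.carrier) : A.halfInvLin W (w ⊗ₜ[ℂ] x) = A.act g x ⊗ₜ[ℂ] w := by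
  rw [halfInvLin, LinearMap.sum_apply, Finset.sum_eq_single g]
  · simp [show W.proj g w = w from hw]
  · intro k _ hk
    simp [hw.ne hk]
  · simp

lemma rho_mul (g g' : G) {h k : G} (hk : h * (g * g') = g * g' * k) {x : V.carrier}
    (hx : V.IsDeg h x) :
    A.rho (g * g') x = (TwistedDouble.phase ω k g g' : ℂ) • A.rho g' (A.rho g x) := by
  have hk' : k = g'⁻¹ * (g⁻¹ * h * g) * g' := by
    have : k = (g * g')⁻¹ * (h * (g * g')) := by rw [hk]; group
    rw [this]; group
  have e := A.act_act g g' k _ (hk' ▸ A.isDeg_rho g' _ _ (A.isDeg_rho g _ _ hx))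
  rw [A.act_rho, A.act_rho] at e
  conv_lhs => rw [e]
  rw [map_smul, A.rho_act]

lemma halfLin_proj (W : GradedVec ω) (a : G) (t : V.carrier ⊗[ℂ] W.carrier) :
    A.halfLin W (tensorProj V W a t) = tensorProj W V a (A.halfLin W t) := by
  have : A.halfLin W ∘ₗ tensorProj V W a = tensorProj W V a ∘ₗ A.halfLin W := by
    refine lin_ext₂ fun x y v w hv hw => ?_
    have e := hw.tmul (A.isDeg_rho y x v hv)
    rw [show y * (y⁻¹ * x * y) = x * y by group] at e
    rw [LinearMap.comp_apply, LinearMap.comp_apply, A.halfLin_tmul hw]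
    by_cases ha : a = x * y
    · subst ha
      rw [tensorProj_eq hv hw, A.halfLin_tmul hw]
      exact e.symm
    · rw [tensorProj_ne hv hw ha, map_zero]
      exact (e.ne ha).symm
  exact LinearMap.congr_fun this t

/-- The half-braiding given by a twisted action. -/
noncomputable def halfIso (W : GradedVec ω) : V ⊗ W ≅ W ⊗ V :=
  isoMk (V := tensor V W) (W := tensor W V) ⟨A.halfLin W, A.halfLin_proj W⟩
    (A.halfInvLin W)
    (lin_ext₂ fun x y v w hv hw => by
      change A.halfInvLin W (A.halfLin W _) = _
      rw [A.halfLin_tmul hw, A.halfInvLin_tmul hw, A.act_rho, LinearMap.id_apply])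
    (lin_ext₂ fun x y v w hv hw => by
      change A.halfLin W (A.halfInvLin W _) = _
      rw [A.halfInvLin_tmul hv, A.halfLin_tmul hv, A.rho_act, LinearMap.id_apply])

/-- The object of the center given by a twisted action. -/
noncomputable def toCenter : TwistedDouble ω :=
  ⟨V, {
    β := A.halfIso
    monoidal := fun W W' => Hom.ext <|
      lin_ext₃' (U := V) (V := W) (W := W') fun h g g' x w w' hx hw hw' => by
        change A.halfLin (tensor W W') (x ⊗ₜ[ℂ] (w ⊗ₜ[ℂ] w')) =
          assocInvLin W W' V (TensorProduct.map LinearMap.id (A.halfLin W')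
            (assocLin W V W' (TensorProduct.map (A.halfLin W) LinearMap.id
              (assocInvLin V W W' (x ⊗ₜ[ℂ] (w ⊗ₜ[ℂ] w'))))))
        have d1 := A.isDeg_rho g h x hx
        have d2 := A.isDeg_rho g' _ _ d1
        have e1 := assocInvLin_tmul hx hw hw'
        have e2 := assocLin_tmul hw d1 hw'
        have e3 := assocInvLin_tmul hw hw' d2
        rw [A.halfLin_tmul (hw.tmul hw'), e1, map_smul, map_smul, map_smul, map_smul,
          TensorProduct.map_tmul, A.halfLin_tmul hw, LinearMap.id_apply, e2, map_smul, map_smul,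
          TensorProduct.map_tmul, A.halfLin_tmul hw', LinearMap.id_apply, e3,
          A.rho_mul g g' (h := h) (k := g'⁻¹ * (g⁻¹ * h * g) * g') (by group) hx,
          TensorProduct.tmul_smul, smul_smul, smul_smul, TwistedDouble.phase,
          show g * g' * (g'⁻¹ * (g⁻¹ * h * g) * g') * (g * g')⁻¹ = h by group,
          show g' * (g'⁻¹ * (g⁻¹ * h * g) * g') * g'⁻¹ = g⁻¹ * h * g by group,
          Units.val_mul, Units.val_mul, mul_assoc (_ : ℂ)]
    naturality := fun {W W'} f => Hom.ext <|
      lin_ext₂ (V := V) (W := W) fun h g x w hx hw => by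
        change A.halfLin W' (x ⊗ₜ[ℂ] Hom.toLin f w) =
          TensorProduct.map (Hom.toLin f) LinearMap.id (A.halfLin W (x ⊗ₜ[ℂ] w))
        rw [A.halfLin_tmul (hw.map f), A.halfLin_tmul hw, TensorProduct.map_tmul]
        rfl }⟩

lemma rho_toCenter (g : G) : A.toCenter.rho g = A.rho g := by
  refine LinearMap.ext fun x : V.carrier => ?_
  have h := A.toCenter.halfLin_pt g x
  have h' : A.halfLin (pt ω g) (x ⊗ₜ[ℂ] (1 : ℂ)) = (1 : ℂ) ⊗ₜ[ℂ] A.rho g x :=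
    A.halfLin_tmul (pt_isDeg g (1 : ℂ)) x
  have h1 := congrArg (TensorProduct.lid ℂ V.carrier) (h.symm.trans h')
  erw [TensorProduct.lid_tmul, TensorProduct.lid_tmul, one_smul, one_smul] at h1
  exact h1

lemma act_toCenter (g : G) : A.toCenter.act g = A.act g := by
  refine LinearMap.ext fun x : V.carrier => ?_
  have h := A.toCenter.act_rho g (A.act g x)
  rw [rho_toCenter] at h
  exact (congrArg (A.toCenter.act g) (A.rho_act g x)).symm.trans h

end TwistedAction

namespace TwistedDouble

/-! ### Stable subspaces and simple objects -/

/-- A subspace of an object of the center that underlies a subobject. -/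
structure Stable (X : TwistedDouble ω) (S : Submodule ℂ X.1.carrier) : Prop where
  proj : ∀ g, ∀ x ∈ S, X.1.proj g x ∈ S
  act : ∀ g, ∀ x ∈ S, X.act g x ∈ S
  rho : ∀ g, ∀ x ∈ S, X.rho g x ∈ S

namespace Stable

variable {X : TwistedDouble ω} {S : Submodule ℂ X.1.carrier} (hS : X.Stable S)

/-- The graded vector space underlying a subobject. -/
noncomputable abbrev graded : GradedVec ω where
  carrier := S
  proj g := (X.1.proj g).restrict (hS.proj g)
  proj_self g v := Subtype.ext (X.1.proj_self g v)
  proj_ne g h v hgh := Subtype.ext (X.1.proj_ne g h v hgh)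
  sum_proj v := Subtype.ext (by
    rw [AddSubmonoidClass.coe_finsetSum]
    exact X.1.sum_proj v)

lemma isDeg_graded {g : G} {v : S} : hS.graded.IsDeg g v ↔ X.1.IsDeg g (v : X.1.carrier) :=
  Subtype.ext_iff

/-- The twisted action on a subobject. -/
noncomputable def action : TwistedAction ω hS.graded where
  act g := (X.act g).restrict (hS.act g)
  rho g := (X.rho g).restrict (hS.rho g)
  act_rho g x := Subtype.ext (X.act_rho g x)
  rho_act g x := Subtype.ext (X.rho_act g x)
  isDeg_rho g _ _ hx := hS.isDeg_graded.mpr (isDeg_rho g (hS.isDeg_graded.mp hx))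
  act_act g g' _ _ hx := Subtype.ext (TwistedDouble.act_act g g' (hS.isDeg_graded.mp hx))

/-- The inclusion of a subobject. -/
noncomputable def incl : hS.action.toCenter ⟶ X :=
  homMk (X := hS.action.toCenter) ⟨S.subtype, fun _ _ => rfl⟩ fun g x => by
    rw [TwistedAction.rho_toCenter]
    rfl

end Stable

variable {X : TwistedDouble ω}

lemma mono_of_injective {X Y : TwistedDouble ω} (f : X ⟶ Y)
    (hf : Function.Injective (toLin f)) : Mono f :=
  ⟨fun g h e => hom_ext fun z => hf (by
    have := congrArg (fun k => toLin k z) e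
    exact this)⟩

/-- The inclusion of the subobject is a nonzero monomorphism into a simple object, hence an
isomorphism. -/
lemma Stable.eq_top [Simple X] {S : Submodule ℂ X.1.carrier} (hS : X.Stable S) (h0 : S ≠ ⊥) :
    S = ⊤ := by
  have hm : Mono hS.incl := mono_of_injective _ Subtype.val_injective
  have hne : hS.incl ≠ 0 := by
    intro e
    apply h0
    rw [Submodule.eq_bot_iff]
    intro x hx
    have := congrArg (fun k => toLin k (⟨x, hx⟩ : S)) e
    exact this
  have hi := (Simple.mono_isIso_iff_nonzero hS.incl).mpr hne
  rw [Submodule.eq_top_iff']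
  intro x
  have h1 : toLin hS.incl (toLin (inv hS.incl) x) = x := by
    have := congrArg (fun k => toLin k x) (IsIso.inv_hom_id hS.incl)
    exact this
  rw [← h1]
  exact Subtype.property _

lemma stable_ker {X Y : TwistedDouble ω} (f : X ⟶ Y) : X.Stable (LinearMap.ker (toLin f)) where
  proj g x hx := by rw [LinearMap.mem_ker] at *; rw [toLin_proj, hx, map_zero]
  act g x hx := by rw [LinearMap.mem_ker] at *; rw [toLin_act, hx, map_zero]
  rho g x hx := by rw [LinearMap.mem_ker] at *; rw [toLin_rho, hx, map_zero]

lemma stable_range {X Y : TwistedDouble ω} (f : X ⟶ Y) :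
    Y.Stable (LinearMap.range (toLin f)) where
  proj g := by rintro _ ⟨x, rfl⟩; exact ⟨_, toLin_proj f g x⟩
  act g := by rintro _ ⟨x, rfl⟩; exact ⟨_, toLin_act f g x⟩
  rho g := by rintro _ ⟨x, rfl⟩; exact ⟨_, toLin_rho f g x⟩

/-- The kernel underlies a subobject, whose inclusion and the zero map have the same composite with
`f`. -/
lemma injective_of_mono {X Y : TwistedDouble ω} (f : X ⟶ Y) [Mono f] :
    Function.Injective (toLin f) := by
  rw [← LinearMap.ker_eq_bot, Submodule.eq_bot_iff]
  intro x hx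
  have h : (stable_ker f).incl ≫ f = 0 ≫ f := hom_ext fun z => by
    rw [Limits.zero_comp]
    exact z.2
  have := congrArg (fun k => toLin k (⟨x, hx⟩ : LinearMap.ker (toLin f))) ((cancel_mono f).mp h)
  exact this

lemma isIso_of_bijective {X Y : TwistedDouble ω} (f : X ⟶ Y)
    (hf : Function.Bijective (toLin f)) : IsIso f := by
  let e := LinearEquiv.ofBijective (toLin f) hf
  have : IsIso (Center.Hom.f f) :=
    (isoMk (Center.Hom.f f) e.symm.toLinearMap (LinearMap.ext fun x => e.symm_apply_apply x)
      (LinearMap.ext fun x => e.apply_symm_apply x)).isIso_hom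
  exact Center.isIso_of_f_isIso f

lemma simple_of_stable [Nontrivial X.1.carrier]
    (h : ∀ S : Submodule ℂ X.1.carrier, X.Stable S → S ≠ ⊥ → S = ⊤) : Simple X where
  mono_isIso_iff_nonzero {Y} f _ := by
    constructor
    · rintro hi rfl
      obtain ⟨x, hx⟩ := exists_ne (0 : X.1.carrier)
      apply hx
      have := congrArg (fun k => toLin k x) (IsIso.inv_hom_id (0 : Y ⟶ X))
      exact this.symm
    · intro hf
      refine isIso_of_bijective f ⟨injective_of_mono f, ?_⟩
      rw [← LinearMap.range_eq_top]
      refine h _ (stable_range f) fun h0 => hf (hom_ext fun y => ?_)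
      exact (Submodule.eq_bot_iff _).mp h0 _ ⟨y, rfl⟩

lemma nontrivial_of_simple [Simple X] : Nontrivial X.1.carrier := by
  by_contra hn
  rw [not_nontrivial_iff_subsingleton] at hn
  have h1 : IsIso (0 : X ⟶ X) := isIso_of_bijective _
    ⟨fun _ _ _ => Subsingleton.elim _ _, fun x => ⟨0, Subsingleton.elim _ _⟩⟩
  exact (Simple.mono_isIso_iff_nonzero (0 : X ⟶ X)).mp h1 rfl

end TwistedDouble
end CenterAction

/-! ### The braiding, the twist and the borromean braid on homogeneous vectors. -/

section Traces

open GradedVec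

/-- `tr ((A ⊗ B) ∘ swap) = tr (A B)` -/
lemma trace_map_comp_comm {V : Type} [AddCommGroup V] [Module ℂ V] [FiniteDimensional ℂ V]
    (A B : V →ₗ[ℂ] V) :
    LinearMap.trace ℂ (V ⊗[ℂ] V)
      (TensorProduct.map A B ∘ₗ (TensorProduct.comm ℂ V V).toLinearMap) =
      LinearMap.trace ℂ V (A ∘ₗ B) := by
  classical
  let b := Module.finBasis ℂ V
  rw [LinearMap.trace_eq_matrix_trace ℂ (b.tensorProduct b),
    LinearMap.trace_eq_matrix_trace ℂ b, LinearMap.toMatrix_comp b b b, Matrix.trace,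
    Matrix.trace, Fintype.sum_prod_type]
  simp only [Matrix.diag_apply, Matrix.mul_apply, LinearMap.toMatrix_apply,
    LinearMap.comp_apply, Module.Basis.tensorProduct_apply, LinearEquiv.coe_coe,
    TensorProduct.comm_tmul, TensorProduct.map_tmul, Module.Basis.tensorProduct_repr_tmul_apply,
    smul_eq_mul]
  refine Finset.sum_congr rfl fun i _ => Finset.sum_congr rfl fun j _ => mul_comm _ _

variable {G : Type} [Group G] [Fintype G] {ω : ThreeCocycle G}

namespace TwistedDouble

/-- The braiding `σ_{X, Y}` as a linear map. -/
noncomputable def braidLin (X Y : TwistedDouble ω) :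
    X.1.carrier ⊗[ℂ] Y.1.carrier →ₗ[ℂ] Y.1.carrier ⊗[ℂ] X.1.carrier :=
  toLin (β_ X Y).hom

/-- The inverse braiding `σ_{X, Y}⁻¹` as a linear map. -/
noncomputable def braidInvLin (X Y : TwistedDouble ω) :
    Y.1.carrier ⊗[ℂ] X.1.carrier →ₗ[ℂ] X.1.carrier ⊗[ℂ] Y.1.carrier :=
  toLin (β_ X Y).inv

/-- The braid `σ₂⁻¹ σ₁` as a linear map. -/
noncomputable def braidStepLin (X Y Z : TwistedDouble ω) :
    (X.1.carrier ⊗[ℂ] Y.1.carrier) ⊗[ℂ] Z.1.carrier →ₗ[ℂ]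
      (Y.1.carrier ⊗[ℂ] Z.1.carrier) ⊗[ℂ] X.1.carrier :=
  toLin (braidStep X Y Z)

lemma braidLin_tmul (X Y : TwistedDouble ω) {g : G} {x : X.1.carrier}
    (hx : X.1.IsDeg g x) (y : Y.1.carrier) :
    braidLin X Y (x ⊗ₜ[ℂ] y) = Y.act g y ⊗ₜ[ℂ] x := by
  have h : Center.Hom.f (β_ X Y).hom = (Y.2.β X.1).inv := IsIso.Iso.inv_hom _
  rw [← Y.halfInvLin_tmul hx]
  exact LinearMap.congr_fun (congrArg Hom.toLin h) _

lemma braidInvLin_tmul (X Y : TwistedDouble ω) {g : G} {x : X.1.carrier}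
    (hx : X.1.IsDeg g x) (y : Y.1.carrier) :
    braidInvLin X Y (y ⊗ₜ[ℂ] x) = x ⊗ₜ[ℂ] Y.rho g y :=
  Y.halfLin_tmul hx y

lemma braidStepLin_eq (X Y Z : TwistedDouble ω) (t) :
    braidStepLin X Y Z t =
      assocInvLin Y.1 Z.1 X.1 (TensorProduct.map LinearMap.id (braidInvLin Z X)
        (assocLin Y.1 X.1 Z.1 (TensorProduct.map (braidLin X Y) LinearMap.id t))) := by
  have h1 : toLin (α_ Y Z X).inv = assocInvLin Y.1 Z.1 X.1 :=
    congrArg Hom.toLin (Center.associator_inv_f Y Z X)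
  exact LinearMap.congr_fun h1 _

lemma braidStepLin_tmul (X Y Z : TwistedDouble ω) {g h k : G} {x : X.1.carrier}
    {y : Y.1.carrier} {z : Z.1.carrier} (hx : X.1.IsDeg g x) (hy : Y.1.IsDeg h y)
    (hz : Z.1.IsDeg k z) :
    braidStepLin X Y Z ((x ⊗ₜ[ℂ] y) ⊗ₜ[ℂ] z) =
      ((ω.val (g * h * g⁻¹) g k * (ω.val (g * h * g⁻¹) k (k⁻¹ * g * k))⁻¹ : ℂˣ) : ℂ) •
        ((Y.act g y ⊗ₜ[ℂ] z) ⊗ₜ[ℂ] X.rho k x) := by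
  rw [braidStepLin_eq, TensorProduct.map_tmul, braidLin_tmul X Y hx, LinearMap.id_apply,
    assocLin_tmul (isDeg_act g hy) hx hz, map_smul, TensorProduct.map_tmul,
    braidInvLin_tmul Z X hz, LinearMap.id_apply, map_smul,
    assocInvLin_tmul (isDeg_act g hy) hz (isDeg_rho k hx), smul_smul, Units.val_mul]

variable (X : TwistedDouble ω)

/-- The twist `x ↦ act |x| x`. -/
noncomputable def twist : X.1.carrier →ₗ[ℂ] X.1.carrier := ∑ g : G, X.act g ∘ₗ X.1.proj g

variable {X}

lemma twist_of_isDeg {g : G} {x : X.1.carrier} (hx : X.1.IsDeg g x) : X.twist x = X.act g x := by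
  rw [twist, LinearMap.sum_apply, Finset.sum_eq_single g]
  · rw [LinearMap.comp_apply, show X.1.proj g x = x from hx]
  · intro k _ hk
    rw [LinearMap.comp_apply, hx.ne hk, map_zero]
  · simp

/-- On degree `g` of the first factor the braiding is a flip followed by `act g ⊗ proj g`; the trace
of such a map is the trace of the composite of its two factors. -/
lemma ptr_braiding_self : ptr (β_ X X).hom = LinearMap.trace ℂ X.1.carrier X.twist := by
  have : braidLin X X = ∑ g : G, TensorProduct.map (X.act g) (X.1.proj g) ∘ₗ
      (TensorProduct.comm ℂ X.1.carrier X.1.carrier).toLinearMap := by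
    refine lin_ext₂ (V := X.1) (W := X.1) fun g h x y hx hy => ?_
    rw [LinearMap.sum_apply, Finset.sum_eq_single g]
    · rw [LinearMap.comp_apply, LinearEquiv.coe_coe, TensorProduct.comm_tmul,
        TensorProduct.map_tmul, show X.1.proj g x = x from hx]
      exact braidLin_tmul X X hx y
    · intro k _ hk
      rw [LinearMap.comp_apply, LinearEquiv.coe_coe, TensorProduct.comm_tmul,
        TensorProduct.map_tmul, hx.ne hk, TensorProduct.tmul_zero]
    · simp
  change LinearMap.trace ℂ (X.1.carrier ⊗[ℂ] X.1.carrier) (braidLin X X) = _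
  rw [this, twist, map_sum, map_sum]
  exact Finset.sum_congr rfl fun g _ => trace_map_comp_comm _ _

lemma proj_twist (g : G) (x : X.1.carrier) : X.1.proj g (X.twist x) = X.twist (X.1.proj g x) := by
  have : X.1.proj g ∘ₗ X.twist = X.twist ∘ₗ X.1.proj g := lin_ext fun k v hv => by
    rw [LinearMap.comp_apply, LinearMap.comp_apply, twist_of_isDeg hv]
    have hd := isDeg_act k hv
    rw [mul_inv_cancel_right] at hd
    by_cases hg : g = k
    · subst hg
      rw [show X.1.proj g v = v from hv, twist_of_isDeg hv]
      exact hd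
    · rw [hv.ne hg, hd.ne hg, map_zero]
  exact LinearMap.congr_fun this x

/-- For `v` of degree `k`, both sides are multiples of `act (g k) v`. The two phases agree: each
collapses to the inverse of `ω (g k g⁻¹, g, k)`. -/
lemma act_twist (g : G) (x : X.1.carrier) : X.act g (X.twist x) = X.twist (X.act g x) := by
  have : X.act g ∘ₗ X.twist = X.twist ∘ₗ X.act g := lin_ext fun k v hv => by
    rw [LinearMap.comp_apply, LinearMap.comp_apply, twist_of_isDeg hv,
      twist_of_isDeg (isDeg_act g hv), act_act _ _ hv, act_act _ _ hv, inv_mul_cancel_right]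
    congr 2
    simp only [phase]
    rw [show g * k * k * (g * k)⁻¹ = g * k * g⁻¹ by group,
      show g * k * g⁻¹ * g * k * (g * k * g⁻¹ * g)⁻¹ = g * k * g⁻¹ by group]
    simp
  exact LinearMap.congr_fun this x

lemma rho_twist (g : G) (x : X.1.carrier) : X.rho g (X.twist x) = X.twist (X.rho g x) := by
  apply act_injective g
  rw [act_rho, act_twist, act_rho]

lemma stable_ker_twist_sub (c : ℂ) :
    X.Stable (LinearMap.ker (X.twist - c • LinearMap.id)) where
  proj g x hx := by
    rw [LinearMap.mem_ker, LinearMap.sub_apply, sub_eq_zero] at *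
    rw [← proj_twist, hx]
    simp
  act g x hx := by
    rw [LinearMap.mem_ker, LinearMap.sub_apply, sub_eq_zero] at *
    rw [← act_twist, hx]
    simp
  rho g x hx := by
    rw [LinearMap.mem_ker, LinearMap.sub_apply, sub_eq_zero] at *
    rw [← rho_twist, hx]
    simp

lemma T_eq_of_twist {X : SimpleObj ω} {c : ℂ} (h : ∀ x, X.1.twist x = c • x) : T X = c := by
  have := X.2
  have := nontrivial_of_simple (X := X.1)
  have h1 : X.1.twist = c • LinearMap.id := LinearMap.ext h
  rw [T, ptr_braiding_self, h1, map_smul, LinearMap.trace_id, smul_eq_mul,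
    mul_div_cancel_right₀]
  exact_mod_cast (Module.finrank_pos (R := ℂ) (M := X.1.1.carrier)).ne'

/-- Schur's lemma: an eigenspace of the twist is stable, so it is everything; taking the trace
identifies the eigenvalue with `T X`. -/
lemma twist_eq_smul (X : SimpleObj ω) (x : X.1.1.carrier) : X.1.twist x = T X • x := by
  have := X.2
  have := nontrivial_of_simple (X := X.1)
  obtain ⟨c, hc⟩ := Module.End.exists_eigenvalue X.1.twist
  obtain ⟨v, hv⟩ := hc.exists_hasEigenvector
  have h1 : LinearMap.ker (X.1.twist - c • LinearMap.id) = ⊤ := by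
    refine (stable_ker_twist_sub (X := X.1) c).eq_top fun h0 => hv.2 ?_
    rw [← Submodule.mem_bot ℂ, ← h0, LinearMap.mem_ker, LinearMap.sub_apply, sub_eq_zero,
      hv.apply_eq_smul]
    simp
  have h2 : ∀ x, X.1.twist x = c • x := fun x => by
    have h3 : x ∈ LinearMap.ker (X.1.twist - c • LinearMap.id) := by rw [h1]; trivial
    rwa [LinearMap.mem_ker, LinearMap.sub_apply, sub_eq_zero] at h3
  rw [T_eq_of_twist h2, h2]

lemma B_eq_trace (X Y Z : SimpleObj ω) :
    B X Y Z = LinearMap.trace ℂ ((X.1.1.carrier ⊗[ℂ] Y.1.1.carrier) ⊗[ℂ] Z.1.1.carrier)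
      (braidStepLin Z.1 X.1 Y.1 ∘ₗ braidStepLin Y.1 Z.1 X.1 ∘ₗ braidStepLin X.1 Y.1 Z.1) :=
  rfl

end TwistedDouble
end Traces

/-! ### Supports and dimensions of homogeneous components. -/

section Support

open GradedVec

variable {G : Type} [Group G] [Fintype G] {ω : ThreeCocycle G}

namespace TwistedDouble

variable {X : TwistedDouble ω}

lemma exists_isDeg_ne_zero [Simple X] : ∃ g x, X.1.IsDeg g x ∧ x ≠ 0 := by
  have := nontrivial_of_simple (X := X)
  obtain ⟨x, hx⟩ := exists_ne (0 : X.1.carrier)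
  by_contra! h
  exact hx ((X.1.sum_proj x).symm.trans
    (Finset.sum_eq_zero fun g _ => h g _ (X.1.isDeg_proj g x)))

/-- The sum of the components in a conjugation-invariant set of degrees is a subobject. -/
lemma stable_of_conj_invariant {P : G → Prop} (hP : ∀ g x, P x → P (g * x * g⁻¹)) :
    ∃ S : Submodule ℂ X.1.carrier, X.Stable S ∧
      ∀ x, x ∈ S ↔ ∀ k, ¬ P k → X.1.proj k x = 0 := by
  refine ⟨⨅ k, ⨅ _ : ¬ P k, LinearMap.ker (X.1.proj k), ⟨?_, ?_, ?_⟩, by simp⟩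
  · intro g x hx
    simp only [Submodule.mem_iInf, LinearMap.mem_ker] at hx ⊢
    intro k hk
    by_cases h : k = g
    · subst h; rw [hx k hk, map_zero]
    · exact X.1.proj_ne _ _ _ h
  · intro g x hx
    simp only [Submodule.mem_iInf, LinearMap.mem_ker] at hx ⊢
    intro k hk
    have h1 := act_proj g (g⁻¹ * k * g) x
    rw [show g * (g⁻¹ * k * g) * g⁻¹ = k by group] at h1
    rw [← h1, hx, map_zero]
    intro h2
    apply hk
    have := hP g _ h2
    rwa [show g * (g⁻¹ * k * g) * g⁻¹ = k by group] at this
  · intro g x hx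
    simp only [Submodule.mem_iInf, LinearMap.mem_ker] at hx ⊢
    intro k hk
    have h1 := rho_proj g (g * k * g⁻¹) x
    rw [show g⁻¹ * (g * k * g⁻¹) * g = k by group] at h1
    rw [← h1, hx, map_zero]
    intro h2
    apply hk
    have := hP g⁻¹ _ h2
    rwa [show g⁻¹ * (g * k * g⁻¹) * g⁻¹⁻¹ = k by group] at this

/-- The part of `X` with degrees in `P` is stable and contains `x`, so simplicity makes it all of
`X`. -/
lemma eq_zero_of_not_mem_support [Simple X] {P : G → Prop}
    (hP : ∀ g x, P x → P (g * x * g⁻¹)) {g : G} {x : X.1.carrier} (hx : X.1.IsDeg g x)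
    (hx0 : x ≠ 0) (hg : P g) {h : G} {y : X.1.carrier} (hy : X.1.IsDeg h y) (hh : ¬ P h) :
    y = 0 := by
  obtain ⟨S, hS, hmem⟩ := stable_of_conj_invariant (X := X) hP
  have htop := hS.eq_top fun h0 => hx0 <| by
    rw [← Submodule.mem_bot ℂ, ← h0, hmem]
    intro k hk
    exact hx.ne fun e => hk (e ▸ hg)
  have h1 : y ∈ S := by rw [htop]; trivial
  rw [← show X.1.proj h y = y from hy]
  exact (hmem y).mp h1 h hh

/-- The dimension of the component of degree `g`. -/
noncomputable def dimAt (X : TwistedDouble ω) (g : G) : ℕ :=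
  Module.finrank ℂ (LinearMap.range (X.1.proj g))

lemma trace_proj (g : G) : LinearMap.trace ℂ X.1.carrier (X.1.proj g) = X.dimAt g := by
  refine LinearMap.IsProj.trace ⟨fun x => ⟨x, rfl⟩, ?_⟩
  rintro _ ⟨x, rfl⟩
  exact X.1.proj_self g x

/-- The two projections are conjugate under `act g`, so their traces coincide. -/
lemma dimAt_conj (g h : G) : X.dimAt (g * h * g⁻¹) = X.dimAt h := by
  have h1 : X.1.proj (g * h * g⁻¹) = X.act g ∘ₗ (X.1.proj h ∘ₗ X.rho g) := by
    refine LinearMap.ext fun x => ?_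
    rw [LinearMap.comp_apply, LinearMap.comp_apply, act_proj, act_rho]
  have h2 : (X.1.proj h ∘ₗ X.rho g) ∘ₗ X.act g = X.1.proj h := by
    refine LinearMap.ext fun x => ?_
    rw [LinearMap.comp_apply, LinearMap.comp_apply, rho_act]
  have h3 : ((X.dimAt (g * h * g⁻¹) : ℕ) : ℂ) = X.dimAt h := by
    rw [← trace_proj, ← trace_proj, h1, LinearMap.trace_comp_comm', h2]
  exact_mod_cast h3

lemma dimAt_eq_zero {g : G} (h : ∀ x, X.1.IsDeg g x → x = 0) : X.dimAt g = 0 := by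
  have : X.1.proj g = 0 := LinearMap.ext fun x => h _ (X.1.isDeg_proj g x)
  rw [dimAt, this, LinearMap.range_zero, finrank_bot]

lemma dimAt_ne_zero {g : G} {x : X.1.carrier} (hx : X.1.IsDeg g x) (h0 : x ≠ 0) :
    X.dimAt g ≠ 0 := by
  intro h
  rw [dimAt, Submodule.finrank_eq_zero, LinearMap.range_eq_bot] at h
  apply h0
  rw [← show X.1.proj g x = x from hx, h, LinearMap.zero_apply]

/-- The trace of an operator that is scalar on the homogeneous components. -/
lemma trace_of_scalar {X Y Z : GradedVec ω}
    (F : (X.carrier ⊗[ℂ] Y.carrier) ⊗[ℂ] Z.carrier →ₗ[ℂ]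
      (X.carrier ⊗[ℂ] Y.carrier) ⊗[ℂ] Z.carrier) (e : G → G → ℂ)
    (hF : ∀ g h k x y z, X.IsDeg g x → Y.IsDeg h y → Z.IsDeg k z →
      F ((x ⊗ₜ y) ⊗ₜ z) = e h k • ((x ⊗ₜ y) ⊗ₜ z)) :
    LinearMap.trace ℂ _ F = Module.finrank ℂ X.carrier *
      ∑ h, ∑ k, e h k * (LinearMap.trace ℂ _ (Y.proj h) * LinearMap.trace ℂ _ (Z.proj k)) := by
  have h1 : F = ∑ h, ∑ k, e h k •
      TensorProduct.map (TensorProduct.map LinearMap.id (Y.proj h)) (Z.proj k) := by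
    refine lin_ext₃ fun g h k x y z hx hy hz => ?_
    rw [hF g h k x y z hx hy hz, LinearMap.sum_apply, Finset.sum_eq_single h,
      LinearMap.sum_apply, Finset.sum_eq_single k]
    · rw [LinearMap.smul_apply, TensorProduct.map_tmul, TensorProduct.map_tmul,
        show Y.proj h y = y from hy, show Z.proj k z = z from hz, LinearMap.id_apply]
    · intro c _ hc; simp [hz.ne hc]
    · simp
    · intro c _ hc; simp [hy.ne hc]
    · simp
  rw [h1, map_sum, Finset.mul_sum]
  refine Finset.sum_congr rfl fun h _ => ?_
  rw [map_sum, Finset.mul_sum]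
  refine Finset.sum_congr rfl fun k _ => ?_
  rw [map_smul, LinearMap.trace_tensorProduct', LinearMap.trace_tensorProduct',
    LinearMap.trace_id, smul_eq_mul]
  ring

end TwistedDouble

/-! ### Monomial objects -/

/-- A conjugation-invariant set of degrees, together with a family of scalars by which the
elements of `G` permute basis vectors indexed by this set. -/
structure MonomialDatum (ω : ThreeCocycle G) where
  supp : G → Prop
  conj : ∀ g x, supp x → supp (g * x * g⁻¹)
  coeff : G → G → ℂˣ
  coeff_mul : ∀ g g' x, supp x →
    coeff g (g' * x * g'⁻¹) * coeff g' x = TwistedDouble.phase ω x g g' * coeff (g * g') x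

namespace MonomialDatum

variable (M : MonomialDatum ω)

/-- Conjugation on the set of degrees. -/
def conjMap (g : G) (x : {x // M.supp x}) : {x // M.supp x} := ⟨g * x * g⁻¹, M.conj g x x.2⟩

omit [Fintype G] in
lemma conjMap_conjMap (g h : G) (x : {x // M.supp x}) :
    M.conjMap g (M.conjMap h x) = M.conjMap (g * h) x :=
  Subtype.ext (by simp only [conjMap]; group)

omit [Fintype G] in
lemma conjMap_one (x : {x // M.supp x}) : M.conjMap 1 x = x :=
  Subtype.ext (by simp [conjMap])

open Classical in
/-- Functions on the set of degrees, as a graded vector space. -/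
noncomputable abbrev graded : GradedVec ω where
  carrier := {x // M.supp x} → ℂ
  proj g := LinearMap.pi fun x => if (x : G) = g then LinearMap.proj x else 0
  proj_self g v := by
    ext x
    by_cases h : (x : G) = g <;> simp [h]
  proj_ne g h v hgh := by
    ext x
    by_cases h' : (x : G) = g
    · simp [h', hgh]
    · simp [h']
  sum_proj v := by
    ext x
    rw [Finset.sum_apply, Finset.sum_eq_single (x : G)]
    · simp
    · intro g _ hg
      simp [hg.symm]
    · simp

lemma isDeg_iff {g : G} {v : {x // M.supp x} → ℂ} :
    M.graded.IsDeg g v ↔ ∀ x : {x // M.supp x}, (x : G) ≠ g → v x = 0 := by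
  classical
  constructor
  · intro h x hx
    have := congrFun h x
    simp only [LinearMap.pi_apply, if_neg hx, LinearMap.zero_apply] at this
    exact this.symm
  · intro h
    funext x
    by_cases hx : (x : G) = g
    · simp [hx]
    · simp [hx, h x hx]

/-- The twisted action by monomial matrices. -/
noncomputable def action : TwistedAction ω M.graded where
  act g := LinearMap.pi fun x => (M.coeff g (M.conjMap g⁻¹ x) : ℂ) •
    LinearMap.proj (M.conjMap g⁻¹ x)
  rho g := LinearMap.pi fun x => (((M.coeff g x)⁻¹ : ℂˣ) : ℂ) • LinearMap.proj (M.conjMap g x)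
  act_rho g v := by
    funext x
    simp [conjMap_conjMap, conjMap_one]
  rho_act g v := by
    funext x
    simp [conjMap_conjMap, conjMap_one]
  isDeg_rho g h v hv := by
    rw [isDeg_iff] at hv ⊢
    intro x hx
    have : v (M.conjMap g x) = 0 := hv _ fun e => hx (by rw [← e]; simp only [conjMap]; group)
    simp [this]
  act_act g g' k v hv := by
    rw [isDeg_iff] at hv
    funext x
    simp only [LinearMap.pi_apply, LinearMap.smul_apply, LinearMap.proj_apply, smul_eq_mul,
      Pi.smul_apply, conjMap_conjMap]
    rw [← mul_inv_rev]
    by_cases hx : (M.conjMap (g * g')⁻¹ x : G) = k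
    · have h1 := M.coeff_mul g g' _ (M.conjMap (g * g')⁻¹ x).2
      have h2 : g' * (M.conjMap (g * g')⁻¹ x : G) * g'⁻¹ = M.conjMap g⁻¹ x := by
        simp only [conjMap]; group
      rw [h2] at h1
      have h3 := congrArg (Units.val) h1
      rw [Units.val_mul, Units.val_mul, hx] at h3
      rw [← mul_assoc, ← mul_assoc, hx, h3]
    · rw [hv _ hx]; simp

/-- The object of the center. -/
noncomputable abbrev obj : TwistedDouble ω := M.action.toCenter

open Classical in
lemma act_single (g : G) (x : {x // M.supp x}) :
    M.obj.act g (Pi.single x (1 : ℂ) : {x // M.supp x} → ℂ) =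
      (M.coeff g x : ℂ) • (Pi.single (M.conjMap g x) (1 : ℂ) : {x // M.supp x} → ℂ) := by
  rw [TwistedAction.act_toCenter]
  funext y
  change (M.coeff g (M.conjMap g⁻¹ y) : ℂ) * (Pi.single x (1 : ℂ) : {x // M.supp x} → ℂ)
    (M.conjMap g⁻¹ y) = (M.coeff g x : ℂ) *
      (Pi.single (M.conjMap g x) (1 : ℂ) : {x // M.supp x} → ℂ) y
  by_cases h : y = M.conjMap g x
  · subst h
    simp [conjMap_conjMap, conjMap_one]
  · have h' : M.conjMap g⁻¹ y ≠ x := by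
      rintro rfl
      exact h (by simp [conjMap_conjMap, conjMap_one])
    rw [Pi.single_eq_of_ne h, Pi.single_eq_of_ne h', mul_zero, mul_zero]

open Classical in
lemma isDeg_single (x : {x // M.supp x}) :
    M.obj.1.IsDeg x (Pi.single x (1 : ℂ) : {x // M.supp x} → ℂ) :=
  M.isDeg_iff.mpr fun _ hy => Pi.single_eq_of_ne (fun e => hy (congrArg Subtype.val e)) _

omit [Fintype G] in
open Classical in
lemma single_ne_zero (x : {x // M.supp x}) :
    (Pi.single x (1 : ℂ) : {x // M.supp x} → ℂ) ≠ 0 := fun h => by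
  have h1 := congrFun h x
  rw [Pi.single_eq_same] at h1
  exact one_ne_zero h1

/-- The components are lines indexed by a single conjugacy class. Projecting a nonzero vector of a
stable subspace yields one basis vector, and `act` moves it to all the others up to nonzero scalars.
-/
lemma simple_obj {x₀ : G} (h₀ : M.supp x₀) (h : ∀ x, M.supp x → ∃ g, g * x₀ * g⁻¹ = x) :
    Simple M.obj := by
  classical
  have : Nontrivial ({x // M.supp x} → ℂ) := by
    have : Nonempty {x // M.supp x} := ⟨⟨x₀, h₀⟩⟩
    infer_instance
  have : Nontrivial M.obj.1.carrier := this
  refine TwistedDouble.simple_of_stable fun S hS hS0 => ?_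
  obtain ⟨v, hv, hv0⟩ := (Submodule.ne_bot_iff S).mp hS0
  obtain ⟨x, hx⟩ : ∃ x, (show {x // M.supp x} → ℂ from v) x ≠ 0 := by
    by_contra! h
    exact hv0 (funext h)
  have hstep : ∀ (g : G) (x : {x // M.supp x}),
      (Pi.single x (1 : ℂ) : {x // M.supp x} → ℂ) ∈ S →
      (Pi.single (M.conjMap g x) (1 : ℂ) : {x // M.supp x} → ℂ) ∈ S := by
    intro g x hx
    have h1 := hS.act g _ hx
    rw [act_single] at h1
    exact (Submodule.smul_mem_iff S (Units.ne_zero _)).mp h1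
  have hsingle : (Pi.single x (1 : ℂ) : {x // M.supp x} → ℂ) ∈ S := by
    have h1 := hS.proj x v hv
    have h2 : M.obj.1.proj x v = (show {x // M.supp x} → ℂ from v) x •
        (Pi.single x (1 : ℂ) : {x // M.supp x} → ℂ) := by
      funext y
      change (if (y : G) = x then LinearMap.proj y else 0 : ({x // M.supp x} → ℂ) →ₗ[ℂ] ℂ) v = _
      by_cases hy : y = x
      · subst hy; simp
      · have : (y : G) ≠ x := fun e => hy (Subtype.ext e)
        rw [if_neg this, Pi.smul_apply, Pi.single_eq_of_ne hy, smul_zero]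
        rfl
    rw [h2] at h1
    exact (Submodule.smul_mem_iff S hx).mp h1
  have hall : ∀ y, (Pi.single y (1 : ℂ) : {x // M.supp x} → ℂ) ∈ S := by
    intro y
    obtain ⟨g, hg⟩ := h x x.2
    obtain ⟨k, hk⟩ := h y y.2
    have : y = M.conjMap (k * g⁻¹) x := by
      apply Subtype.ext
      simp only [conjMap]
      rw [← hk, ← hg]
      group
    rw [this]
    exact hstep _ _ hsingle
  rw [Submodule.eq_top_iff']
  intro (w : {x // M.supp x} → ℂ)
  have hw : w = ∑ y, w y • (Pi.single y (1 : ℂ) : {x // M.supp x} → ℂ) :=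
    pi_eq_sum_univ' w
  rw [hw]
  exact Submodule.sum_mem S fun y _ => S.smul_mem _ (hall y)

lemma T_obj (h : Simple M.obj) {x : G} (hx : M.supp x) :
    TwistedDouble.T ⟨M.obj, h⟩ = M.coeff x x := by
  classical
  have h1 := TwistedDouble.twist_eq_smul ⟨M.obj, h⟩
    (Pi.single ⟨x, hx⟩ (1 : ℂ) : {x // M.supp x} → ℂ)
  have h2 : M.conjMap x ⟨x, hx⟩ = ⟨x, hx⟩ := Subtype.ext (by simp [conjMap])
  rw [TwistedDouble.twist_of_isDeg (M.isDeg_single ⟨x, hx⟩), act_single, h2] at h1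
  have h3 := congrFun h1 ⟨x, hx⟩
  change _ * (Pi.single ⟨x, hx⟩ (1 : ℂ) : {x // M.supp x} → ℂ) ⟨x, hx⟩ =
    _ * (Pi.single ⟨x, hx⟩ (1 : ℂ) : {x // M.supp x} → ℂ) ⟨x, hx⟩ at h3
  rw [Pi.single_eq_same, mul_one, mul_one] at h3
  exact h3.symm

end MonomialDatum

end Support

/-! ### Sums of `q`-th roots of unity and characters from `ℤ/p` to `ℤ/q`. -/

section NumberTheory

variable {p q : ℕ} [Fact p.Prime] [Fact q.Prime]

open Finset

lemma isPrimitiveRoot_stdAddChar_one :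
    IsPrimitiveRoot (ZMod.stdAddChar (1 : ZMod q)) q := by
  rw [IsPrimitiveRoot.iff_def]
  constructor
  · rw [← AddChar.map_nsmul_eq_pow]
    simp
  · intro l hl
    rw [← AddChar.map_nsmul_eq_pow, nsmul_one, ← AddChar.map_zero_eq_one (ZMod.stdAddChar (N := q))] at hl
    exact (ZMod.natCast_eq_zero_iff l q).mp (ZMod.injective_stdAddChar hl)

/-- For prime `q`, the integral relations among the `q`-th roots of unity are the multiples of the
one with all coefficients equal. -/
lemma eq_of_sum_stdAddChar_eq_zero {f : ZMod q → ℤ}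
    (hf : ∑ c, (f c : ℂ) * ZMod.stdAddChar c = 0) (a b : ZMod q) : f a = f b := by
  have h1 := (IsPrimitiveRoot.sum_eq_zero_iff_forall_eq_int (Fact.out : q.Prime)
    (isPrimitiveRoot_stdAddChar_one (q := q)) fun i => f (ZMod.finEquiv q i)).mp ?_
  · simpa using h1 ((ZMod.finEquiv q).symm a) ((ZMod.finEquiv q).symm b)
  · rw [← hf]
    refine Fintype.sum_equiv (ZMod.finEquiv q).toEquiv _ _ fun i => ?_
    have h2 : ZMod.finEquiv q i = ((i : ℕ) : ZMod q) := by
      obtain ⟨n, rfl⟩ : ∃ n, q = n + 1 := ⟨q - 1, (Nat.succ_pred_prime Fact.out).symm⟩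
      exact (Fin.cast_val_eq_self i).symm
    rw [← AddChar.map_nsmul_eq_pow, nsmul_one]
    simp only [RingEquiv.toEquiv_eq_coe, EquivLike.coe_coe, h2]

/-- Two positive multiples of sums of `p` distinct `q`-th roots of unity, where `2 p < q`, can
agree only if they involve the same roots of unity. -/
lemma image_eq_of_sum_stdAddChar_eq (hpq : 2 * p < q) {f g : ZMod p → ZMod q}
    {m n : ℕ} (hm : m ≠ 0) (hn : n ≠ 0)
    (h : (m : ℂ) * ∑ x, ZMod.stdAddChar (f x) = n * ∑ x, ZMod.stdAddChar (g x)) :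
    univ.image f = univ.image g := by
  have hcount : ∀ f : ZMod p → ZMod q, ∑ x, ZMod.stdAddChar (f x) =
      ∑ c, ((#{x | f x = c} : ℕ) : ℂ) * ZMod.stdAddChar c := by
    intro f
    rw [← Finset.sum_fiberwise univ f]
    refine sum_congr rfl fun c _ => ?_
    rw [← nsmul_eq_mul, ← sum_const]
    exact sum_congr rfl fun x hx => by rw [(mem_filter.mp hx).2]
  have hconst := eq_of_sum_stdAddChar_eq_zero (q := q)
    (f := fun c => (m : ℤ) * (#{x | f x = c} : ℕ) - n * (#{x | g x = c} : ℕ)) (by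
      rw [hcount f, hcount g, mul_sum, mul_sum, ← sub_eq_zero, ← sum_sub_distrib] at h
      rw [← h]
      refine sum_congr rfl fun c _ => ?_
      push_cast
      ring)
  -- The two images have at most `2 p < q` elements together, so some root occurs on neither side;
  -- this forces the common difference of the multiplicities to vanish.
  obtain ⟨c₀, hc₀⟩ : ∃ c, c ∉ univ.image f ∪ univ.image g := by
    by_contra! hall
    have h1 : #(univ.image f ∪ univ.image g) = q := by
      rw [(eq_univ_iff_forall).mpr hall, card_univ, ZMod.card]
    have h2 := card_union_le (univ.image f) (univ.image g)
    have h3 := card_image_le (s := univ) (f := f)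
    have h4 := card_image_le (s := univ) (f := g)
    rw [card_univ, ZMod.card] at h3 h4
    omega
  simp only [mem_union, mem_image, mem_univ, true_and, not_or, not_exists] at hc₀
  have hzero : ∀ c, (m : ℤ) * (#{x | f x = c} : ℕ) = n * (#{x | g x = c} : ℕ) := by
    intro c
    have := hconst c c₀
    simp only [hc₀.1, hc₀.2, filter_false, card_empty] at this
    simpa [sub_eq_zero] using this
  ext c
  have h1 : #{x | f x = c} = 0 ↔ #{x | g x = c} = 0 := by
    have := hzero c
    constructor
    · intro h0
      rw [h0] at this
      simpa [hn] using this.symm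
    · intro h0
      rw [h0] at this
      simpa [hm] using this
  simp only [card_eq_zero, filter_eq_empty_iff, mem_univ, forall_true_left] at h1
  simp only [mem_image, mem_univ, true_and]
  rw [← not_iff_not]
  push Not
  exact h1

/-- A faithful character of `ℤ/p` with values in `ℤ/q`. -/
structure FaithfulChar (N : ZMod p → ZMod q) : Prop where
  map_zero : N 0 = 1
  map_add : ∀ x y, N (x + y) = N x * N y
  inj : ∀ x, N x = 1 → x = 0

namespace FaithfulChar

variable {N : ZMod p → ZMod q}

lemma mul_neg (hN : FaithfulChar N) (x : ZMod p) : N x * N (-x) = 1 := by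
  rw [← hN.map_add, add_neg_cancel, hN.map_zero]

lemma ne_zero (hN : FaithfulChar N) (x : ZMod p) : N x ≠ 0 :=
  left_ne_zero_of_mul_eq_one (hN.mul_neg x)

lemma injective (hN : FaithfulChar N) : Function.Injective N := fun x y h => by
  have h1 : N (x - y) = 1 := by
    rw [sub_eq_add_neg, hN.map_add, h, hN.mul_neg]
  exact sub_eq_zero.mp (hN.inj _ h1)

lemma exists_add_self (hp : Odd p) (x : ZMod p) : ∃ y, x = y + y := by
  obtain ⟨k, hk⟩ := hp
  refine ⟨x * (k + 1), ?_⟩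
  have h1 : ((2 * k + 1 : ℕ) : ZMod p) = 0 := by rw [← hk]; simp
  push_cast at h1
  linear_combination -x * h1

lemma eq_zero_of_add_self (hp : Odd p) {x : ZMod p} (h : x + x = 0) : x = 0 := by
  obtain ⟨k, hk⟩ := hp
  have h1 : ((2 * k + 1 : ℕ) : ZMod p) = 0 := by rw [← hk]; simp
  push_cast at h1
  linear_combination x * h1 - k * h

lemma two_ne_zero_of_odd (hq : Odd q) : (2 : ZMod q) ≠ 0 := by
  intro h
  obtain ⟨k, hk⟩ := hq
  have h1 : ((2 * k + 1 : ℕ) : ZMod q) = 0 := by rw [← hk]; simp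
  push_cast at h1
  have : (1 : ZMod q) = 0 := by linear_combination h1 - k * h
  exact one_ne_zero this

lemma ne_neg_one (hN : FaithfulChar N) (hp : Odd p) (hq : Odd q) (x : ZMod p) : N x ≠ -1 := by
  intro h
  have h1 : N (x + x) = 1 := by rw [hN.map_add, h]; ring
  have h2 := eq_zero_of_add_self hp (hN.inj _ h1)
  rw [h2, hN.map_zero] at h
  exact two_ne_zero_of_odd hq (by linear_combination h)

/-- The difference of two values factors as `(N x - N y) (1 + N (-x) N (-y))`, and the second factor
is nonzero because a character of odd order never takes the value `-1`. -/
lemma sub_neg_injective (hN : FaithfulChar N) (hp : Odd p) (hq : Odd q) :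
    Function.Injective fun x => N x - N (-x) := fun x y h => by
  have h0 : N x - N (-x) = N y - N (-y) := h
  have hx := hN.mul_neg x
  have hy := hN.mul_neg y
  have h1 : (N x - N y) * (1 + N (-x) * N (-y)) = 0 := by
    linear_combination h0 + N (-y) * hx - N (-x) * hy
  rcases mul_eq_zero.mp h1 with h2 | h2
  · exact hN.injective (sub_eq_zero.mp h2)
  · rw [← hN.map_add] at h2
    exact absurd (by linear_combination h2) (hN.ne_neg_one hp hq (-x + -y))

lemma sum_eq_zero (hN : FaithfulChar N) {a : ZMod p} (ha : a ≠ 0) : ∑ x, N x = 0 := by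
  have h1 : ∑ x, N x = N a * ∑ x, N x := by
    rw [mul_sum, ← Equiv.sum_comp (Equiv.addLeft a) N]
    exact sum_congr rfl fun x _ => hN.map_add a x
  have h2 : (N a - 1) * ∑ x, N x = 0 := by linear_combination -h1
  refine (mul_eq_zero.mp h2).resolve_left fun h => ha (hN.inj a (sub_eq_zero.mp h))

/-- Expand the square. Doubling permutes `ℤ/p`, so `N x ^ 2 = N (2 x)` sums to zero, and likewise
for `-x`; each cross term is `-2`. -/
lemma sum_sq (hN : FaithfulChar N) (hp : Odd p) :
    ∑ x, (N x - N (-x)) ^ 2 = -(2 * p : ZMod q) := by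
  have hne : (1 : ZMod p) ≠ 0 := one_ne_zero
  have hdouble : Function.Bijective fun x : ZMod p => x + x := by
    refine Function.Surjective.bijective_of_finite fun x => ?_
    obtain ⟨y, hy⟩ := exists_add_self hp x
    exact ⟨y, hy.symm⟩
  have h1 : ∑ x, N x ^ 2 = 0 := by
    rw [← hN.sum_eq_zero hne, ← hdouble.sum_comp N]
    exact sum_congr rfl fun x _ => by rw [hN.map_add, sq]
  have h2 : ∑ x, N (-x) ^ 2 = 0 := by
    rw [← h1, ← Equiv.sum_comp (Equiv.neg (ZMod p)) fun x => N x ^ 2]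
    rfl
  have h3 : ∀ x, (N x - N (-x)) ^ 2 = N x ^ 2 + N (-x) ^ 2 + -2 := fun x => by
    linear_combination -2 * hN.mul_neg x
  simp only [h3, sum_add_distrib, h1, h2, sum_const, card_univ, ZMod.card, nsmul_eq_mul]
  ring

/-- Compare the sums of squares over the two sets: they are `-2 p` times `(N x - N (-x)) ^ 2` and
`(N y - N (-y)) ^ 2`, and `2 p` is invertible modulo `q`. -/
lemma eq_or_eq_neg_of_image_eq (hN : FaithfulChar N) (hp : Odd p) (hq : Odd q) (hpq : p < q)
    {x y : ZMod p} (hx : x ≠ 0) (hy : y ≠ 0)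
    (h : univ.image (fun z => (N x - N (-x)) * (N z - N (-z))) =
      univ.image fun z => (N y - N (-y)) * (N z - N (-z))) : x = y ∨ x = -y := by
  have hinj := hN.sub_neg_injective hp hq
  have hne : ∀ x : ZMod p, x ≠ 0 → N x - N (-x) ≠ 0 := fun x hx h => hx (hinj (by simp [h]))
  have hsum : ∀ x : ZMod p, x ≠ 0 →
      ∑ c ∈ univ.image (fun z => (N x - N (-x)) * (N z - N (-z))), c ^ 2 =
        (N x - N (-x)) ^ 2 * -(2 * p : ZMod q) := by
    intro x hx
    rw [sum_image fun a _ b _ hab => hinj (mul_left_cancel₀ (hne x hx) hab), ← hN.sum_sq hp,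
      mul_sum]
    exact sum_congr rfl fun z _ => mul_pow _ _ _
  have h1 := hsum x hx
  rw [h, hsum y hy] at h1
  have hp0 : (p : ZMod q) ≠ 0 := fun e =>
    (Nat.le_of_dvd (Fact.out : p.Prime).pos ((ZMod.natCast_eq_zero_iff p q).mp e)).not_gt hpq
  have h2 := mul_right_cancel₀ (neg_ne_zero.mpr (mul_ne_zero (two_ne_zero_of_odd hq) hp0)) h1
  rcases sq_eq_sq_iff_eq_or_eq_neg.mp h2 with h3 | h3
  · exact Or.inl (hinj h3).symm
  · refine Or.inr (hinj ?_)
    simp only [neg_neg]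
    linear_combination h3

/-- The exponents in the borromean tensor factor once `y = 2 x`. -/
lemma sum_stdAddChar_eq (hN : FaithfulChar N) {x y : ZMod p} (hy : y = x + x) :
    ∑ z, ZMod.stdAddChar ((N (-y) - 1) * N (-z) + (N y - 1) * N z) =
      ∑ z, ZMod.stdAddChar ((N x - N (-x)) * (N z - N (-z))) := by
  -- Replacing `z` by `z + x` on the right makes the expanded product match the left side term by
  -- term.
  rw [← Equiv.sum_comp (Equiv.addRight x) fun z =>
    ZMod.stdAddChar ((N x - N (-x)) * (N z - N (-z)))]
  refine sum_congr rfl fun z _ => ?_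
  congr 1
  simp only [Equiv.coe_addRight]
  have h1 := hN.mul_neg x
  rw [hy, neg_add, neg_add, hN.map_add, hN.map_add, hN.map_add, hN.map_add]
  linear_combination (N z + N (-z)) * h1

lemma eq_or_eq_neg_of_sum_eq (hN : FaithfulChar N) (hp : Odd p) (hq : Odd q) (hpq : 2 * p < q)
    {m n : ℕ} (hm : m ≠ 0) (hn : n ≠ 0) {i j : ZMod p} (hi : i ≠ 0) (hj : j ≠ 0)
    (h : (m : ℂ) * ∑ z, ZMod.stdAddChar ((N (-i) - 1) * N (-z) + (N i - 1) * N z) =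
      n * ∑ z, ZMod.stdAddChar ((N (-j) - 1) * N (-z) + (N j - 1) * N z)) :
    i = j ∨ i = -j := by
  obtain ⟨x, rfl⟩ := exists_add_self hp i
  obtain ⟨y, rfl⟩ := exists_add_self hp j
  have hx : x ≠ 0 := fun e => hi (by rw [e, add_zero])
  have hy : y ≠ 0 := fun e => hj (by rw [e, add_zero])
  rw [hN.sum_stdAddChar_eq rfl, hN.sum_stdAddChar_eq rfl] at h
  rcases hN.eq_or_eq_neg_of_image_eq hp hq (by omega) hx hy
    (image_eq_of_sum_stdAddChar_eq hpq hm hn h) with rfl | rfl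
  · exact Or.inl rfl
  · exact Or.inr (neg_add y y).symm

end FaithfulChar
end NumberTheory

/-! ### The group `ℤ/q ⋊ ℤ/p`: coordinates, twists and fluxes. -/

section PQ

variable {p q : ℕ} [Fact p.Prime] [Fact q.Prime]
  {φ : Multiplicative (ZMod p) →* MulAut (Multiplicative (ZMod q))}

namespace PQGroup

/-- The component in `ℤ/q` of an element of `ℤ/q ⋊ ℤ/p`. -/
def lt (g : PQGroup p q φ) : ZMod q := g.left.toAdd

/-- The component in `ℤ/p` of an element of `ℤ/q ⋊ ℤ/p`. -/
def rt (g : PQGroup p q φ) : ZMod p := g.right.toAdd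

/-- The element with given components. -/
def mk (φ : Multiplicative (ZMod p) →* MulAut (Multiplicative (ZMod q))) (s : ZMod q)
    (j : ZMod p) : PQGroup p q φ := ⟨.ofAdd s, .ofAdd j⟩

/-- The multiplier by which an element of `ℤ/p` acts on `ℤ/q`. -/
def mult (φ : Multiplicative (ZMod p) →* MulAut (Multiplicative (ZMod q))) (j : ZMod p) :
    ZMod q := (φ (.ofAdd j) (.ofAdd 1)).toAdd

lemma toAdd_apply (j : Multiplicative (ZMod p)) (s : Multiplicative (ZMod q)) :
    (φ j s).toAdd = mult φ j.toAdd * s.toAdd := by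
  let f : ZMod q →+ ZMod q := (φ j).toMonoidHom.toAdditive
  have h : ∀ t : ZMod q, f t = f 1 * t := fun t => by
    have := ZMod.map_smul f t 1
    rwa [smul_eq_mul, mul_one, smul_eq_mul, mul_comm] at this
  exact h s.toAdd

@[simp] lemma lt_mk (s : ZMod q) (j : ZMod p) : lt (mk φ s j) = s := rfl
@[simp] lemma rt_mk (s : ZMod q) (j : ZMod p) : rt (mk φ s j) = j := rfl
@[simp] lemma lt_one : lt (1 : PQGroup p q φ) = 0 := rfl
@[simp] lemma rt_one : rt (1 : PQGroup p q φ) = 0 := rfl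
@[simp] lemma rt_mul (g h : PQGroup p q φ) : rt (g * h) = rt g + rt h := rfl
@[simp] lemma rt_inv (g : PQGroup p q φ) : rt g⁻¹ = -rt g := rfl

@[simp] lemma lt_mul (g h : PQGroup p q φ) : lt (g * h) = lt g + mult φ (rt g) * lt h := by
  simp only [lt, SemidirectProduct.mul_left, toAdd_mul, toAdd_apply]
  rfl

@[simp] lemma lt_inv (g : PQGroup p q φ) : lt g⁻¹ = -(mult φ (-rt g) * lt g) := by
  simp only [lt, SemidirectProduct.inv_left, toAdd_apply, toAdd_inv, mul_neg]
  rfl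

@[ext] lemma ext {g h : PQGroup p q φ} (h₁ : lt g = lt h) (h₂ : rt g = rt h) : g = h :=
  SemidirectProduct.ext h₁ h₂

lemma faithfulChar_mult (hφ : φ ≠ 1) : FaithfulChar (mult φ) := by
  have h0 : mult φ 0 = 1 := by simp [mult]
  have hadd : ∀ x y, mult φ (x + y) = mult φ x * mult φ y := fun x y => by
    rw [mult, ofAdd_add, map_mul, MulAut.mul_apply, toAdd_apply]
    rfl
  refine ⟨h0, hadd, fun x hx => ?_⟩
  by_contra hx0
  apply hφ
  have hn : ∀ n : ℕ, mult φ (n * x) = 1 := fun n => by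
    induction n with
    | zero => simp [h0]
    | succ n ih => rw [Nat.cast_succ, add_mul, one_mul, hadd, ih, hx, one_mul]
  refine MonoidHom.ext fun j => MulEquiv.ext fun s => Multiplicative.toAdd.injective ?_
  rw [toAdd_apply]
  have := hn (j.toAdd * x⁻¹).val
  rw [ZMod.natCast_zmod_val, mul_assoc, inv_mul_cancel₀ hx0, mul_one] at this
  rw [this, one_mul]
  rfl

lemma mk_pow (s : ZMod q) (n : ℕ) : mk φ s 0 ^ n = mk φ (n * s) 0 := by
  induction n with
  | zero => ext <;> simp
  | succ n ih =>
    have h0 : mult φ 0 = 1 := by simp [mult]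
    rw [pow_succ, ih]
    ext
    · simp [h0, add_mul]
    · simp

lemma rt_pow (g : PQGroup p q φ) (n : ℕ) : rt (g ^ n) = n * rt g := by
  induction n with
  | zero => simp
  | succ n ih => rw [pow_succ, rt_mul, ih]; push_cast; ring

/-- `g ^ p` lies in `ℤ/q` and commutes with `g`, which acts there by multiplication by a scalar
other than `1`. -/
lemma pow_eq_one (hφ : φ ≠ 1) {g : PQGroup p q φ} (hg : rt g ≠ 0) : g ^ p = 1 := by
  have hN := faithfulChar_mult hφ
  have h1 : rt (g ^ p) = 0 := by rw [rt_pow]; simp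
  have h2 := congrArg lt (pow_mul_comm' g p)
  rw [lt_mul, lt_mul, h1, hN.map_zero] at h2
  have h3 : (mult φ (rt g) - 1) * lt (g ^ p) = 0 := by linear_combination -h2
  ext
  · exact (mul_eq_zero.mp h3).resolve_left fun h => hg (hN.inj _ (sub_eq_zero.mp h))
  · exact h1

end PQGroup

open PQGroup GradedVec TwistedDouble

variable {u : ℕ}

lemma pqCocycle_val (x y z : PQGroup p q φ) : ((pqCocycle p q φ u).val x y z : ℂ) =
    Complex.exp (2 * Real.pi * Complex.I / (p : ℂ) ^ 2 *
      ((u * ((rt x).val * ThreeCocycle.carry p (rt y) (rt z)) : ℤ) : ℂ)) := by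
  change Complex.exp _ ^ u = _
  rw [← Complex.exp_nat_mul]
  congr 1
  push_cast
  simp only [rt, SemidirectProduct.rightHom_eq_right]
  ring

lemma pqCocycle_eq_one {x y z : PQGroup p q φ} (h : rt x = 0 ∨ rt y = 0 ∨ rt z = 0) :
    (pqCocycle p q φ u).val x y z = 1 := by
  apply Units.ext
  rw [pqCocycle_val]
  rcases h with h | h | h <;> simp [h, ThreeCocycle.carry]

/-- The cocycle is inflated from an abelian group, so conjugation does not affect it, and it is
symmetric in its last two arguments. Two of the three factors of `phase` therefore cancel. -/
lemma phase_pqCocycle (k g g' : PQGroup p q φ) :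
    phase (pqCocycle p q φ u) k g g' = ((pqCocycle p q φ u).val k g g')⁻¹ := by
  have h1 : (pqCocycle p q φ u).val (g * g' * k * (g * g')⁻¹) g g' =
      (pqCocycle p q φ u).val k g g' := by
    apply Units.ext
    simp only [pqCocycle_val, rt_mul, rt_inv]
    rw [show rt g + rt g' + rt k + -(rt g + rt g') = rt k by ring]
  have h2 : (pqCocycle p q φ u).val g (g' * k * g'⁻¹) g' = (pqCocycle p q φ u).val g g' k := by
    apply Units.ext
    simp only [pqCocycle_val, rt_mul, rt_inv]
    rw [show rt g' + rt k + -rt g' = rt k by ring]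
    simp only [ThreeCocycle.carry, add_comm (rt k)]
    congr 4
    ring
  rw [phase, h1, h2, mul_inv_cancel_right]

lemma phase_eq_one {k g g' : PQGroup p q φ} (h : rt k = 0 ∨ rt g = 0 ∨ rt g' = 0) :
    phase (pqCocycle p q φ u) k g g' = 1 := by
  rw [phase_pqCocycle, pqCocycle_eq_one h, inv_one]

section Support

variable {X : TwistedDouble (pqCocycle p q φ u)}

lemma act_act_of_rt_eq_zero {k : PQGroup p q φ} {x : X.1.carrier} (hx : X.1.IsDeg k x)
    (hk : rt k = 0) (g g' : PQGroup p q φ) : X.act g (X.act g' x) = X.act (g * g') x := by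
  rw [act_act g g' hx, phase_eq_one (Or.inl hk), Units.val_one, one_smul]

lemma rho_eq_act_inv {k : PQGroup p q φ} {x : X.1.carrier} (hx : X.1.IsDeg k x)
    (hk : rt k = 0) (g : PQGroup p q φ) : X.rho g x = X.act g⁻¹ x := by
  apply act_injective g
  rw [act_rho, act_act_of_rt_eq_zero hx hk, mul_inv_cancel, act_one]

/-- The phases accumulated in passing from `(act g) ^ n` to `act (g ^ n)` have carries that
telescope to `n [i] - [n i]`, where `i = rt g`. -/
lemma act_pow_of_isDeg {g : PQGroup p q φ} {x : X.1.carrier} (hx : X.1.IsDeg g x) (n : ℕ) :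
    X.act (g ^ n) x = Complex.exp (2 * Real.pi * Complex.I / (p : ℂ) ^ 2 *
      ((u * ((rt g).val * (n * (rt g).val - (n * rt g : ZMod p).val)) : ℤ) : ℂ)) •
      (X.act g ^ n) x := by
  induction n with
  | zero => simp [act_one]
  | succ n ih =>
    have h1 := act_act g (g ^ n) hx
    rw [phase_pqCocycle, ← pow_succ', ih, map_smul] at h1
    have h2 : X.act (g ^ (n + 1)) x = ((pqCocycle p q φ u).val g g (g ^ n) : ℂ) •
        (Complex.exp (2 * Real.pi * Complex.I / (p : ℂ) ^ 2 *
          ((u * ((rt g).val * (n * (rt g).val - (n * rt g : ZMod p).val)) : ℤ) : ℂ)) •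
            X.act g ((X.act g ^ n) x)) := by
      rw [h1, smul_smul, ← Units.val_mul, mul_inv_cancel, Units.val_one, one_smul]
    rw [h2, pqCocycle_val, smul_smul, ← Complex.exp_add, pow_succ' (X.act g), rt_pow,
      Module.End.mul_apply]
    congr 2
    rw [← mul_add, ← Int.cast_add, ThreeCocycle.carry,
      show ((n + 1 : ℕ) : ZMod p) * rt g = rt g + n * rt g by push_cast; ring]
    congr 2
    push_cast
    ring

/-- Apply `act_pow_of_isDeg` with `n = p`: then `g ^ p = 1` acts trivially, and the exponent `u [i]
(p [i] - 0) / p²` reduces to `u [i]² / p`. -/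
lemma T_pow (hφ : φ ≠ 1) (Y : SimpleObj (pqCocycle p q φ u)) {g : PQGroup p q φ}
    {x : Y.1.1.carrier} (hx : Y.1.1.IsDeg g x) (hx0 : x ≠ 0) (hg : rt g ≠ 0) :
    T Y ^ p = Complex.exp (-(2 * Real.pi * Complex.I / p * (u * (rt g).val ^ 2 : ℕ))) := by
  have h1 : ∀ n : ℕ, (Y.1.act g ^ n) x = T Y ^ n • x := fun n => by
    induction n with
    | zero => simp
    | succ n ih =>
      rw [pow_succ', Module.End.mul_apply, ih, map_smul, ← twist_of_isDeg hx, twist_eq_smul,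
        smul_smul, ← pow_succ]
  have h2 := act_pow_of_isDeg hx p
  rw [pow_eq_one hφ hg, act_one, h1, smul_smul] at h2
  have hp0 : (p : ℂ) ≠ 0 := Nat.cast_ne_zero.mpr (NeZero.ne p)
  have h3 := smul_left_injective ℂ hx0 ((one_smul ℂ x).trans h2)
  rw [Complex.exp_neg, ← mul_eq_one_iff_eq_inv₀ (Complex.exp_ne_zero _), mul_comm]
  refine Eq.trans ?_ h3.symm
  congr 2
  simp only [CharP.cast_eq_zero, zero_mul, ZMod.val_zero]
  push_cast
  field_simp
  ring

lemma T_pow_sq (hφ : φ ≠ 1) (Y : SimpleObj (pqCocycle p q φ u)) {g : PQGroup p q φ}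
    {x : Y.1.1.carrier} (hx : Y.1.1.IsDeg g x) (hx0 : x ≠ 0) (hg : rt g ≠ 0) :
    T Y ^ (p ^ 2) = 1 := by
  have hp0 : (p : ℂ) ≠ 0 := Nat.cast_ne_zero.mpr (NeZero.ne p)
  rw [sq p, pow_mul, T_pow hφ Y hx hx0 hg, ← Complex.exp_nat_mul, Complex.exp_eq_one_iff]
  refine ⟨-(u * (rt g).val ^ 2 : ℕ), ?_⟩
  push_cast
  field_simp

lemma T_pow_of_rt_eq_zero (Y : SimpleObj (pqCocycle p q φ u)) {g : PQGroup p q φ}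
    {x : Y.1.1.carrier} (hx : Y.1.1.IsDeg g x) (hg : rt g = 0) (n : ℕ) :
    Y.1.act (g ^ n) x = T Y ^ n • x := by
  induction n with
  | zero => simp [act_one]
  | succ n ih =>
    rw [pow_succ', ← act_act_of_rt_eq_zero hx hg, ih, map_smul, ← twist_of_isDeg hx,
      twist_eq_smul, smul_smul, ← pow_succ]

/-- The degrees of `Y` form the orbit of `s₀ ≠ 0` in `ℤ/q`, the components have dimension `d`, and
the normal subgroup acts on them by scalars. A simple object with twist `exp (2πi / q)` has this
form. -/
structure IsFlux (Y : TwistedDouble (pqCocycle p q φ u)) (d : ℕ) (s₀ : ZMod q) : Prop where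
  ne_zero : s₀ ≠ 0
  dim_ne_zero : d ≠ 0
  supp : ∀ g y, Y.1.IsDeg g y → y ≠ 0 → rt g = 0 ∧ lt g ≠ 0
  act_mk : ∀ g y (m : ZMod q), Y.1.IsDeg g y → y ≠ 0 →
    Y.act (mk φ m 0) y = ZMod.stdAddChar (m * (lt g)⁻¹) • y
  dimAt_orbit : ∀ j, Y.dimAt (mk φ (mult φ j * s₀) 0) = d
  dimAt_not_orbit : ∀ g, (∀ j, g ≠ mk φ (mult φ j * s₀) 0) → Y.dimAt g = 0

/-- A twist of order `q` excludes degrees outside `ℤ/q`, where `T ^ (p ^ 2) = 1`, and also the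
degree `1`, where `T = 1`. Any other degree generates `ℤ/q`, so the whole normal subgroup acts there
by powers of `T`. -/
lemma exists_isFlux (hφ : φ ≠ 1) (hpq : p < q) (Y : SimpleObj (pqCocycle p q φ u))
    (hY : T Y = ZMod.stdAddChar (1 : ZMod q)) : ∃ d s₀, IsFlux Y.1 d s₀ := by
  have := Y.2
  have hN := faithfulChar_mult hφ
  have hprim := isPrimitiveRoot_stdAddChar_one (q := q)
  have hsupp : ∀ g y, Y.1.1.IsDeg g y → y ≠ 0 → rt g = 0 ∧ lt g ≠ 0 := by
    intro g y hy hy0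
    have h1 : rt g = 0 := by
      by_contra hg
      have h1 := T_pow_sq hφ Y hy hy0 hg
      rw [hY] at h1
      have h2 := (Fact.out : q.Prime).dvd_of_dvd_pow (hprim.dvd_of_pow_eq_one _ h1)
      exact (Nat.le_of_dvd (Fact.out : p.Prime).pos h2).not_gt hpq
    refine ⟨h1, fun h2 => ?_⟩
    have h3 := T_pow_of_rt_eq_zero Y hy h1 1
    have h4 : g = 1 := by ext <;> simp [h1, h2]
    rw [h4, one_pow, act_one, pow_one, hY] at h3
    have h5 := smul_left_injective ℂ hy0 ((one_smul ℂ y).trans h3)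
    exact hprim.ne_one (Fact.out : q.Prime).one_lt h5.symm
  obtain ⟨g, x, hx, hx0⟩ := exists_isDeg_ne_zero (X := Y.1)
  obtain ⟨hg, hg'⟩ := hsupp g x hx hx0
  have hg1 : g = mk φ (lt g) 0 := by ext <;> simp [hg]
  have horb : ∀ j, mk φ (mult φ j * lt g) 0 = mk φ 0 j * g * (mk φ 0 j)⁻¹ := fun j => by
    ext <;> simp [hg]
  refine ⟨Y.1.dimAt g, lt g, hg', dimAt_ne_zero hx hx0, hsupp, ?_, ?_, ?_⟩
  · intro k y m hy hy0
    obtain ⟨hk, hk'⟩ := hsupp k y hy hy0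
    have hk1 : k = mk φ (lt k) 0 := by ext <;> simp [hk]
    have h1 := T_pow_of_rt_eq_zero Y hy hk (m * (lt k)⁻¹).val
    -- The exponent solves `n * lt k = m` in `ℤ/q`; this is the origin of the factor `(lt g)⁻¹` in
    -- `IsFlux.act_mk`.
    have h2 : k ^ (m * (lt k)⁻¹).val = mk φ m 0 := by
      conv_lhs => rw [hk1]
      rw [mk_pow, lt_mk, ZMod.natCast_zmod_val, mul_assoc, inv_mul_cancel₀ hk', mul_one]
    rw [h2, hY, ← AddChar.map_nsmul_eq_pow] at h1
    simpa using h1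
  · intro j
    rw [horb, dimAt_conj]
  · intro k hk
    refine dimAt_eq_zero fun y hy => ?_
    refine eq_zero_of_not_mem_support (P := fun k => ∃ j, k = mk φ (mult φ j * lt g) 0) ?_ hx hx0
      ⟨0, ?_⟩ hy (by simpa using hk)
    · rintro h _ ⟨j, rfl⟩
      refine ⟨rt h + j, ?_⟩
      ext
      · simp only [lt_mul, lt_inv, lt_mk, rt_mk, rt_mul, hN.map_add, add_zero]
        linear_combination (-lt h) * hN.mul_neg (rt h)
      · simp
    · rw [hN.map_zero, one_mul]; exact hg1

end Support
end PQ

/-! ### The borromean tensor with two flux strands. -/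

section PQBorromean

variable {p q : ℕ} [Fact p.Prime] [Fact q.Prime]
  {φ : Multiplicative (ZMod p) →* MulAut (Multiplicative (ZMod q))} {u : ℕ}

open PQGroup GradedVec TwistedDouble

lemma braidStepLin_tmul_of_eq_one {G : Type} [Group G] [Fintype G] {ω : ThreeCocycle G}
    (X Y Z : TwistedDouble ω) {g h k : G} {x : X.1.carrier}
    {y : Y.1.carrier} {z : Z.1.carrier} (hx : X.1.IsDeg g x) (hy : Y.1.IsDeg h y)
    (hz : Z.1.IsDeg k z) (h₁ : ω.val (g * h * g⁻¹) g k = 1)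
    (h₂ : ω.val (g * h * g⁻¹) k (k⁻¹ * g * k) = 1) :
    braidStepLin X Y Z ((x ⊗ₜ[ℂ] y) ⊗ₜ[ℂ] z) = (Y.act g y ⊗ₜ[ℂ] z) ⊗ₜ[ℂ] X.rho k x := by
  rw [braidStepLin_tmul X Y Z hx hy hz, h₁, h₂, inv_one, mul_one, Units.val_one, one_smul]

/-- The borromean braid on a flux strand and two strands with degrees in the normal subgroup. -/
lemma borromean_tmul (hφ : φ ≠ 1) {X Y : TwistedDouble (pqCocycle p q φ u)} {d : ℕ} {s₀ : ZMod q}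
    (hY : IsFlux Y d s₀) {g h k : PQGroup p q φ} {x : X.1.carrier} {y z : Y.1.carrier}
    (hx : X.1.IsDeg g x) (hy : Y.1.IsDeg h y) (hz : Y.1.IsDeg k z) (hy0 : y ≠ 0) (hz0 : z ≠ 0) :
    braidStepLin Y X Y (braidStepLin Y Y X (braidStepLin X Y Y ((x ⊗ₜ[ℂ] y) ⊗ₜ[ℂ] z))) =
      ZMod.stdAddChar ((mult φ (-rt g) - 1) * (lt k * (lt h)⁻¹) +
        (mult φ (rt g) - 1) * (lt h * (lt k)⁻¹)) • ((x ⊗ₜ[ℂ] y) ⊗ₜ[ℂ] z) := by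
  have hN := faithfulChar_mult hφ
  obtain ⟨hh, hh'⟩ := hY.supp h y hy hy0
  obtain ⟨hk, hk'⟩ := hY.supp k z hz hz0
  have hy1 := isDeg_act g hy
  have hx1 := isDeg_rho k hx
  -- Degrees in the commutative normal subgroup do not conjugate one another, so the two flux
  -- strands return to their original degrees.
  have ek : g * h * g⁻¹ * k * (g * h * g⁻¹)⁻¹ = k := by
    ext <;> simp [hh, hk, hN.map_zero]
    linear_combination (-2 * lt g) * hN.mul_neg (rt g)
  have hz1 := isDeg_act (g * h * g⁻¹) hz
  rw [ek] at hz1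
  have eh : (k⁻¹ * g * k)⁻¹ * (g * h * g⁻¹) * (k⁻¹ * g * k) = h := by
    ext <;> simp [hh, hk, hN.map_zero]
    linear_combination (lt h + lt k - mult φ (-rt g) * lt g) * hN.mul_neg (rt g)
  have hy2 := isDeg_rho (k⁻¹ * g * k) hy1
  rw [eh] at hy2
  -- Every associator that occurs has an argument in the normal subgroup, so it is trivial.
  rw [braidStepLin_tmul_of_eq_one X Y Y hx hy hz (pqCocycle_eq_one (Or.inl (by simp [hh])))
      (pqCocycle_eq_one (Or.inl (by simp [hh]))),
    braidStepLin_tmul_of_eq_one Y Y X hy1 hz hx1 (pqCocycle_eq_one (Or.inl (by simp [hh, hk])))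
      (pqCocycle_eq_one (Or.inl (by simp [hh, hk]))),
    braidStepLin_tmul_of_eq_one Y X Y hz1 hx1 hy2
      (pqCocycle_eq_one (Or.inr (Or.inl (by simp [hk]))))
      (pqCocycle_eq_one (Or.inr (Or.inl (by simp [hh]))))]
  rw [act_rho, rho_eq_act_inv hy1 (by simp [hh]), act_act_of_rt_eq_zero hy hh,
    rho_eq_act_inv hz1 hk, act_act_of_rt_eq_zero hz hk]
  -- The first strand returns unchanged. Each flux strand is acted on by a commutator of `g` with
  -- the degree of the other flux; it lies in `ℤ/q`, so it acts by a scalar.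
  have e1 : (k⁻¹ * g * k)⁻¹ * g = mk φ ((mult φ (-rt g) - 1) * lt k) 0 := by
    ext <;> simp [hk, hN.map_zero]
    ring
  have e2 : h⁻¹ * (g * h * g⁻¹) = mk φ ((mult φ (rt g) - 1) * lt h) 0 := by
    ext <;> simp [hh, hN.map_zero]
    linear_combination (-lt g) * hN.mul_neg (rt g)
  rw [e1, e2, hY.act_mk h y _ hy hy0, hY.act_mk k z _ hz hz0, AddChar.map_add_eq_mul]
  simp only [TensorProduct.tmul_smul, ← TensorProduct.smul_tmul', smul_smul, mul_assoc]
  rw [mul_comm (ZMod.stdAddChar _)]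

/-- The braid is diagonal on homogeneous vectors, with eigenvalue depending only on the ratio of the
two flux degrees. For degrees `N j * s₀` and `N l * s₀` the ratio is `N (j - l)`, so `s₀` drops out
and the double sum over the orbit is `p` copies of a single one. -/
lemma B_flux (hφ : φ ≠ 1) (X Y : SimpleObj (pqCocycle p q φ u)) {d : ℕ} {s₀ : ZMod q}
    (hY : IsFlux Y.1 d s₀) {i : ZMod p} (hX : ∀ g x, X.1.1.IsDeg g x → x ≠ 0 → rt g = i) :
    B X Y Y = ((Module.finrank ℂ X.1.1.carrier * (d * d * p) : ℕ) : ℂ) *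
      ∑ z, ZMod.stdAddChar ((mult φ (-i) - 1) * mult φ (-z) + (mult φ i - 1) * mult φ z) := by
  have hN := faithfulChar_mult hφ
  have hinj : Function.Injective fun j => mk φ (mult φ j * s₀) 0 := fun j l h =>
    hN.injective (mul_right_cancel₀ hY.ne_zero (congrArg lt h))
  have hzero : ∀ g ∉ Set.range fun j => mk φ (mult φ j * s₀) 0, Y.1.dimAt g = 0 := fun g hg =>
    hY.dimAt_not_orbit g fun j hj => hg ⟨j, hj.symm⟩
  rw [B_eq_trace, trace_of_scalar _ (fun h k =>
    ZMod.stdAddChar ((mult φ (-i) - 1) * (lt k * (lt h)⁻¹) +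
        (mult φ i - 1) * (lt h * (lt k)⁻¹)))]
  · simp only [trace_proj]
    rw [Nat.cast_mul, mul_assoc]
    congr 1
    rw [← Fintype.sum_of_injective _ hinj (fun j => ∑ z,
      ZMod.stdAddChar ((mult φ (-i) - 1) * mult φ (-z) + (mult φ i - 1) * mult φ z) *
        ((d : ℂ) * d)) _ ?_ ?_]
    · rw [Finset.sum_const, Finset.card_univ, ZMod.card, nsmul_eq_mul, ← Finset.sum_mul]
      push_cast
      ring
    · intro g hg
      simp [hzero g hg]
    · intro j
      rw [← Fintype.sum_of_injective _ hinj (fun l =>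
        ZMod.stdAddChar ((mult φ (-i) - 1) * mult φ (-(j - l)) + (mult φ i - 1) * mult φ (j - l)) *
        ((d : ℂ) * d)) _ ?_ ?_]
      · exact (Equiv.sum_comp (Equiv.subLeft j) fun z => ZMod.stdAddChar
          ((mult φ (-i) - 1) * mult φ (-z) + (mult φ i - 1) * mult φ z) * ((d : ℂ) * d)).symm
      · intro g hg
        simp [hzero g hg]
      · intro l
        have hdiv : ∀ j l : ZMod p, mult φ (j - l) = mult φ j * s₀ * (mult φ l * s₀)⁻¹ := by
          intro j l
          rw [eq_mul_inv_iff_mul_eq₀ (mul_ne_zero (hN.ne_zero l) hY.ne_zero), ← mul_assoc,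
            ← hN.map_add, sub_add_cancel]
        simp only [hY.dimAt_orbit, lt_mk, neg_sub, hdiv]
  · intro g h k x y z hx hy hz
    by_cases hx0 : x = 0
    · simp [hx0]
    by_cases hy0 : y = 0
    · simp [hy0]
    by_cases hz0 : z = 0
    · simp [hz0]
    rw [← hX g x hx hx0]
    exact borromean_tmul hφ hY hx hy hz hy0 hz0

end PQBorromean

/-! ### The two test objects and the comparison of cocycles. -/

section PQMain

variable {p q : ℕ} [Fact p.Prime] [Fact q.Prime]
  {φ : Multiplicative (ZMod p) →* MulAut (Multiplicative (ZMod q))}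

open PQGroup GradedVec TwistedDouble

/-- `exp (-2πi (u + p) [j] / p²)` -/
noncomputable def twistChar (u : ℕ) (j : ZMod p) : ℂˣ :=
  ThreeCocycle.expUnit (-(2 * Real.pi * Complex.I / (p : ℂ) ^ 2 * (((u + p) * j.val : ℕ) : ℂ)))

/-- Over `rt k = 1` the phase involves `u` times a carry divided by `p²`. Using `u + p` in place of
`u` multiplies it by `exp` of `2πi` times carry over `p`, which is `1` because `p` divides the
carry. -/
lemma twistChar_mul (φ : Multiplicative (ZMod p) →* MulAut (Multiplicative (ZMod q)))
    (hp : 1 < p) (u : ℕ) (k g g' : PQGroup p q φ) (hk : rt k = 1) :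
    twistChar u (rt g) * twistChar u (rt g') =
      phase (pqCocycle p q φ u) k g g' * twistChar u (rt g + rt g') := by
  have hp0 : (p : ℂ) ≠ 0 := Nat.cast_ne_zero.mpr (NeZero.ne p)
  apply Units.ext
  have : Fact (1 < p) := ⟨hp⟩
  rw [phase_pqCocycle, Units.val_mul, Units.val_mul, Units.val_inv_eq_inv_val, pqCocycle_val,
    ← Complex.exp_neg]
  simp only [twistChar, ThreeCocycle.expUnit, Units.val_mk0]
  rw [← Complex.exp_add, ← Complex.exp_add, Complex.exp_eq_exp_iff_exists_int, hk, ZMod.val_one]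
  obtain ⟨m, hm⟩ := ThreeCocycle.carry_dvd p (rt g) (rt g')
  refine ⟨-m, ?_⟩
  have hm' : ((rt g).val : ℂ) + (rt g').val - (rt g + rt g').val = p * m := by
    have := congrArg (Int.cast : ℤ → ℂ) hm
    simpa [ThreeCocycle.carry] using this
  rw [hm]
  push_cast
  field_simp
  linear_combination (-(u : ℂ) - p) * hm'

/-- A flux with degrees in the coset of the generator of `ℤ/p`. -/
noncomputable def cosetDatum (φ : Multiplicative (ZMod p) →* MulAut (Multiplicative (ZMod q)))
    (hp : 1 < p) (u : ℕ) : MonomialDatum (pqCocycle p q φ u) where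
  supp x := rt x = 1
  conj g x hx := by simp [hx]
  coeff g _ := twistChar u (rt g)
  coeff_mul g g' x hx := twistChar_mul φ hp u x g g' hx

/-- The standard additive character, with values in units. -/
noncomputable def charUnit (c : ZMod q) : ℂˣ :=
  Units.mk0 (ZMod.stdAddChar c) (left_ne_zero_of_mul_eq_one (b := ZMod.stdAddChar (-c)) (by
    rw [← AddChar.map_add_eq_mul, add_neg_cancel, AddChar.map_zero_eq_one]))

/-- A flux with degrees in an orbit on `ℤ/q`. -/
noncomputable def orbitDatum (hφ : φ ≠ 1) (u : ℕ) : MonomialDatum (pqCocycle p q φ u) where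
  supp x := rt x = 0 ∧ ∃ j, lt x = mult φ j
  conj g x := by
    rintro ⟨hx, j, hj⟩
    have hN := faithfulChar_mult hφ
    refine ⟨by simp [hx], rt g + j, ?_⟩
    simp only [lt_mul, lt_inv, rt_mul, hN.map_add, hx, hj, add_zero]
    linear_combination (-lt g) * hN.mul_neg (rt g)
  -- Dividing by the label of the target rather than of the source makes these exponents additive
  -- along products, since `lt (g g') = lt g + N (rt g) * lt g'`.
  coeff g x := charUnit (lt g * (lt (g * x * g⁻¹))⁻¹)
  coeff_mul g g' x := by
    rintro ⟨hx, j, hj⟩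
    have hN := faithfulChar_mult hφ
    have hconj : ∀ (g x : PQGroup p q φ), rt x = 0 →
        lt (g * x * g⁻¹) = mult φ (rt g) * lt x := fun g x hx => by
      simp only [lt_mul, lt_inv, rt_mul, hx, add_zero]
      linear_combination (-lt g) * hN.mul_neg (rt g)
    apply Units.ext
    rw [phase_eq_one (Or.inl hx), one_mul, Units.val_mul]
    simp only [charUnit, Units.val_mk0]
    rw [← AddChar.map_add_eq_mul, hconj (g * g') x hx, hconj g' x hx,
      hconj g _ (by simp [hx]), hconj g' x hx, hj]
    congr 1
    have h1 := hN.ne_zero (rt g)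
    have h2 := hN.ne_zero (rt g')
    have h3 := hN.ne_zero j
    simp only [lt_mul, rt_mul, hN.map_add]
    field_simp

/-- The coset over `1` is a single conjugacy class: conjugating `(0, 1)` by `(s, 0)` gives first
component `s (1 - N 1)`, and `1 - N 1` is invertible. -/
lemma exists_simple_coset (hφ : φ ≠ 1) (u : ℕ) (hu : u < p) :
    ∃ X : SimpleObj (pqCocycle p q φ u), T X ≠ 1 ∧
      ∃ g x, X.1.1.IsDeg g x ∧ x ≠ 0 ∧ rt g = 1 := by
  classical
  have hN := faithfulChar_mult hφ
  have hp1 : 1 < p := (Fact.out : p.Prime).one_lt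
  have : Fact (1 < p) := ⟨hp1⟩
  let M := cosetDatum φ hp1 u
  have h₀ : M.supp (mk φ 0 1) := rt_mk (φ := φ) 0 1
  have hs : Simple M.obj := M.simple_obj h₀ fun x (hx : rt x = 1) => by
    have h1 : (1 : ZMod q) - mult φ 1 ≠ 0 := fun h =>
      one_ne_zero (hN.inj 1 (sub_eq_zero.mp h).symm)
    refine ⟨mk φ (lt x * (1 - mult φ 1)⁻¹) 0, ?_⟩
    ext
    · simp [hN.map_zero]
      field_simp
      ring
    · simp [hx]
  refine ⟨⟨M.obj, hs⟩, ?_, mk φ 0 1, _, M.isDeg_single ⟨_, h₀⟩, M.single_ne_zero _, rt_mk _ _⟩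
  rw [M.T_obj hs h₀]
  change Complex.exp _ ≠ 1
  have hp0 : (p : ℂ) ≠ 0 := Nat.cast_ne_zero.mpr (NeZero.ne p)
  rw [rt_mk, ZMod.val_one, Complex.exp_neg, Ne, inv_eq_one, Complex.exp_eq_one_iff]
  rintro ⟨n, hn⟩
  have h1 : ((u + p : ℕ) : ℂ) = n * p ^ 2 := by
    have h2 : (2 * Real.pi * Complex.I : ℂ) ≠ 0 := Complex.two_pi_I_ne_zero
    field_simp at hn
    push_cast at hn ⊢
    linear_combination hn
  have h2 : ((u + p : ℕ) : ℤ) = n * p ^ 2 := by exact_mod_cast h1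
  -- The summand `p` in `twistChar` matters here: `0 < u + p < 2 p ≤ p ^ 2` keeps the twist away
  -- from `1` even for `u = 0`.
  have h3 : (p ^ 2 : ℕ) ∣ u + p := by
    rw [← Int.natCast_dvd_natCast, h2]
    push_cast
    exact Dvd.intro_left _ rfl
  have h4 := Nat.le_of_dvd (by omega) h3
  nlinarith

lemma exists_simple_orbit (hφ : φ ≠ 1) (u : ℕ) :
    ∃ Y : SimpleObj (pqCocycle p q φ u), T Y = ZMod.stdAddChar (1 : ZMod q) := by
  have hN := faithfulChar_mult hφ
  let M := orbitDatum hφ u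
  have h₀ : M.supp (mk φ 1 0) := ⟨rt_mk _ _, 0, by rw [hN.map_zero, lt_mk]⟩
  have hs : Simple M.obj := M.simple_obj h₀ fun x hx => by
    obtain ⟨hx, j, hj⟩ := hx
    refine ⟨mk φ 0 j, ?_⟩
    ext <;> simp [hx, hj]
  refine ⟨⟨M.obj, hs⟩, ?_⟩
  rw [M.T_obj hs h₀]
  change ZMod.stdAddChar _ = _
  congr 1
  simp

/-- A map of simple objects that preserves the twists and the borromean tensor determines the
cocycle. -/
lemma eq_of_T_eq_of_B_eq (hp : Odd p) (hq : Odd q) (hpq : p ∣ q - 1) (hφ : φ ≠ 1) {u u' : ℕ}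
    (hu : u < p) (hu' : u' < p)
    (κ : SimpleObj (pqCocycle p q φ u) → SimpleObj (pqCocycle p q φ u'))
    (hT : ∀ V, T (κ V) = T V) (hB : ∀ U V W, B (κ U) (κ V) (κ W) = B U V W) : u = u' := by
  have hN := faithfulChar_mult hφ
  have hp1 : 1 < p := (Fact.out : p.Prime).one_lt
  have : Fact (1 < p) := ⟨hp1⟩
  have h2pq : 2 * p < q := by
    obtain ⟨k, hk⟩ := hpq
    obtain ⟨a, rfl⟩ := hp
    obtain ⟨b, rfl⟩ := hq
    have hb : 1 < 2 * b + 1 := (Fact.out : (2 * b + 1).Prime).one_lt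
    -- In `q - 1 = p k`, the value `k = 0` would give `q = 1`, and `k = 1` would make `q = p + 1`
    -- even.
    have : 2 ≤ k := by
      by_contra! h
      interval_cases k <;> omega
    have := Nat.mul_le_mul_left (2 * a + 1) this
    omega
  obtain ⟨X, hX1, g, x, hx, hx0, hg⟩ := exists_simple_coset hφ u hu
  obtain ⟨Y, hY⟩ := exists_simple_orbit hφ u
  have hg0 : rt g ≠ 0 := by rw [hg]; exact one_ne_zero
  have hTsq := T_pow_sq hφ X hx hx0 hg0
  have := (κ X).2
  obtain ⟨g', x', hx', hx0'⟩ := exists_isDeg_ne_zero (X := (κ X).1)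
  -- Otherwise the twist of `κ X` would have order dividing `q`; its order also divides `p ^ 2`, so
  -- `T X` would be `1`.
  have hg0' : rt g' ≠ 0 := by
    intro h0
    have h1 := T_pow_of_rt_eq_zero (κ X) hx' h0 q
    have h2 : g' ^ q = 1 := by
      have : g' = mk φ (lt g') 0 := by ext <;> simp [h0]
      rw [this, mk_pow]
      ext <;> simp
    rw [h2, act_one, hT] at h1
    have h3 := smul_left_injective ℂ hx0' ((one_smul ℂ x').trans h1)
    have hcop : Nat.Coprime (p ^ 2) q := by
      refine Nat.Coprime.pow_left 2 ((Nat.coprime_primes Fact.out Fact.out).mpr ?_)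
      omega
    have h4 := Nat.dvd_gcd (orderOf_dvd_of_pow_eq_one hTsq) (orderOf_dvd_of_pow_eq_one h3.symm)
    rw [hcop] at h4
    exact hX1 (orderOf_eq_one_iff.mp (Nat.dvd_one.mp h4))
  have hTp := T_pow hφ X hx hx0 hg0
  have hTp' := T_pow hφ (κ X) hx' hx0' hg0'
  -- The component in `ℤ/p` is invariant under conjugation, so it is constant on the support of a
  -- simple object.
  have hdeg : ∀ {u : ℕ} (X : SimpleObj (pqCocycle p q φ u)) {g x}, X.1.1.IsDeg g x → x ≠ 0 →
      ∀ h y, X.1.1.IsDeg h y → y ≠ 0 → rt h = rt g := by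
    intro u X g x hx hx0 h y hy hy0
    have := X.2
    by_contra hne
    exact hy0 (eq_zero_of_not_mem_support (P := fun k => rt k = rt g)
      (fun a b hb => by simpa using hb) hx hx0 rfl hy hne)
  obtain ⟨d, s₀, hd⟩ := exists_isFlux hφ (by omega) Y hY
  obtain ⟨d', s₀', hd'⟩ := exists_isFlux hφ (by omega) (κ Y) ((hT Y).trans hY)
  have hBeq := hB X Y Y
  rw [B_flux hφ X Y hd (hdeg X hx hx0), B_flux hφ (κ X) (κ Y) hd' (hdeg (κ X) hx' hx0')] at hBeq
  have hfin : ∀ {u : ℕ} (X : SimpleObj (pqCocycle p q φ u)) {d : ℕ}, d ≠ 0 →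
      Module.finrank ℂ X.1.1.carrier * (d * d * p) ≠ 0 := by
    intro u X d hd
    have := X.2
    have := nontrivial_of_simple (X := X.1)
    exact mul_ne_zero Module.finrank_pos.ne' (mul_ne_zero (mul_ne_zero hd hd) (NeZero.ne p))
  -- The dimensions and orbits of `X`, `Y` and their images may differ, but they enter only through
  -- nonzero integer factors, which this comparison tolerates.
  have hrt := hN.eq_or_eq_neg_of_sum_eq hp hq h2pq (hfin _ hd'.dim_ne_zero)
    (hfin _ hd.dim_ne_zero) hg0' hg0 hBeq
  rw [hT, hTp, Complex.exp_neg, Complex.exp_neg, inv_inj, Complex.exp_eq_exp_iff_exists_int]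
    at hTp'
  obtain ⟨n, hn⟩ := hTp'
  have hp0 : (p : ℂ) ≠ 0 := Nat.cast_ne_zero.mpr (NeZero.ne p)
  have h1 : ((u * (rt g).val ^ 2 : ℕ) : ℂ) = (u' * (rt g').val ^ 2 : ℕ) + n * p := by
    have h2 : (2 * Real.pi * Complex.I : ℂ) ≠ 0 := Complex.two_pi_I_ne_zero
    field_simp at hn
    push_cast at hn ⊢
    linear_combination hn
  have h2 : ((u * (rt g).val ^ 2 : ℕ) : ℤ) = (u' * (rt g').val ^ 2 : ℕ) + n * p := by
    exact_mod_cast h1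
  have h3 := congrArg (Int.cast : ℤ → ZMod p) h2
  push_cast at h3
  rw [ZMod.natCast_zmod_val, ZMod.natCast_zmod_val, ZMod.natCast_self, mul_zero,
    add_zero] at h3
  -- The sign ambiguity is harmless because the twists depend only on the square of the component in
  -- `ℤ/p`.
  have h4 : rt g' ^ 2 = 1 := by
    rcases hrt with h | h <;> rw [h, hg] <;> ring
  rw [h4, hg, one_pow, mul_one, mul_one, ZMod.natCast_eq_natCast_iff'] at h3
  rwa [Nat.mod_eq_of_lt hu, Nat.mod_eq_of_lt hu'] at h3

end PQMain

theorem mainTheorem1 (p q : ℕ) [Fact p.Prime] [Fact q.Prime] (hp : Odd p) (hq : Odd q)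
    (hpq : p ∣ q - 1)
    (φ : Multiplicative (ZMod p) →* MulAut (Multiplicative (ZMod q))) (hφ : φ ≠ 1)
    (u u' : ℕ) (hu : u < p) (hu' : u' < p) :
    (∃ κ : TwistedDouble.SimpleObj (pqCocycle p q φ u) →
          TwistedDouble.SimpleObj (pqCocycle p q φ u'),
        (∀ V, TwistedDouble.T (κ V) = TwistedDouble.T V) ∧
        ∀ U V W, TwistedDouble.B (κ U) (κ V) (κ W) = TwistedDouble.B U V W) ↔
      u = u' := by
  constructor
  · rintro ⟨κ, hT, hB⟩
    exact eq_of_T_eq_of_B_eq hp hq hpq hφ hu hu' κ hT hB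
  · rintro rfl
    exact ⟨id, fun _ => rfl, fun _ _ _ => rfl⟩
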